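/- Let $K=\mathbb F_2$. For $u,v,w\in K^m$ let $|v|$ be the Hamming weight and $|u\cap v|$, $|u\cap v\cap w|$ the number of coordinates in which all the listed vectors equal $1$. A subspace $V\subseteq K^m$ is a doubly even code if $4\mid |v|$ for all $v\in V$; a factor set on $V$ is a map $\phi:V\times V\to\{1,-1\}$ with $$\phi(v,v)=(-1)^{|v|/4},\quad \phi(v,w)=(-1)^{|v\cap w|/2}\phi(w,v),\quad \phi(0,v)=\phi(v,0)=1,$$ $$\phi(v+w,u)=\phi(v,w+u)\,\phi(v,w)\,\phi(w,u)\,(-1)^{|v\cap w\cap u|},$$ and the code loop $L(V)$ is the set $\{1,-1\}\times V$ with the product $(s,v)(t,w)=(st\,\phi(v,w),v+w)$; here $\pm1$ stands for $(\pm1,0)$. Its rank is $\dim V$. Put $[u,v]=(u^{-1}v^{-1})(uv)$ and $(u,v,w)=((uv)w)(u(vw))^{-1}$. For $1\le i\le 16$ let $C_i^4$ be a code loop of rank $4$ (that is, a loop isomorphic to $L(W)$, formed with some factor set, for some doubly even code $W$ of dimension $4$) that is generated by elements $a,b,c,d$ with $(a,b,c)=-1$, $(a,b,d)=(a,c,d)=(b,c,d)=1$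 and $$a^2=(-1)^{\lambda_1},\ b^2=(-1)^{\lambda_2},\ c^2=(-1)^{\lambda_3},\ d^2=(-1)^{\lambda_4},$$ $$[a,b]=(-1)^{\lambda_5},\ [a,c]=(-1)^{\lambda_6},\ [a,d]=(-1)^{\lambda_7},\ [b,c]=(-1)^{\lambda_8},\ [b,d]=(-1)^{\lambda_9},\ [c,d]=(-1)^{\lambda_{10}},$$ where $\lambda=(\lambda_1\dots\lambda_{10})$ is the $i$-th vector in the list below. A representation of a loop $L$, of degree $m$, is a doubly even code $V\subseteq K^m$ with $L\cong L(V)$ for some factor set on $V$. Call two coordinates of $V$ equivalent if every word of $V$ takes the same value at both. The representation is reduced if no coordinate vanishes on all of $V$ and every class of equivalent coordinates has fewer than $8$ elements; it is minimal if it is reduced and its degree is at most the degree of every representation of $L$. Two codes in $K^m$ are equivalent if a permutation of the coordinates maps one onto the other. In the list, $(1,2,5\text{-}7)$ denotes the vector with support $\{1,2,5,6,7\}$, $\langle\cdots\rangle$ is the span, and $m_i$ is the length of $V_i$. 1. $\lambda=(1110110100)$, $m_1=8$, $V_1=\langle(1\text{-}4),(1,2,5,6),(1,3,5,7),(1\text{-}8)\rangle$;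 2. $\lambda=(0000000000)$, $m_2=14$, $V_2=\langle(1\text{-}8),(1\text{-}4,9\text{-}12),(1,5,6,7,9,10,11,13),(1,2,5,8,9,12,13,14)\rangle$; 3. $\lambda=(0000110100)$, $m_3=12$, $V_3=\langle(1\text{-}8),(1\text{-}6,9,10),(1\text{-}5,7,9,11),(1,6\text{-}12)\rangle$; 4. $\lambda=(0010100000)$, $m_4=18$, $V_4=\langle(1\text{-}8),(1\text{-}6,9,10),(1,2,3,7,9,11\text{-}17),(1,4,7,8,9,10,11,18)\rangle$; 5. $\lambda=(0000010100)$, $m_5=18$, $V_5=\langle(1\text{-}8),(1\text{-}4,9\text{-}12),(1,5,9,13\text{-}17),(1,2,5,6,9,10,13,18)\rangle$; 6. $\lambda=(1111110100)$, $m_6=11$, $V_6=\langle(1\text{-}4),(1,2,5,6),(1,3,5,7),(8\text{-}11)\rangle$; 7. $\lambda=(0001000000)$, $m_7=17$, $V_7=\langle(1\text{-}8),(1\text{-}4,9\text{-}12),(1,5,6,7,9,10,11,13),(14\text{-}17)\rangle$; 8. $\lambda=(0000001000)$, $m_8=17$, $V_8=\langle(1\text{-}8),(1\text{-}4,9\text{-}12),(1,2,3,5,9,13,14,15),(1,2,10,11,13,14,16,17)\rangle$;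 9. $\lambda=(0100001000)$, $m_9=19$, $V_9=\langle(1\text{-}8),(1\text{-}4,9\text{-}16),(1,5,6,7,9,10,11,17),(5,6,9,10,12,13,18,19)\rangle$; 10. $\lambda=(0001111000)$, $m_{10}=19$, $V_{10}=\langle(1\text{-}8),(1,2,9\text{-}14),(1,3,9,10,11,15,16,17),(4,5,18,19)\rangle$; 11. $\lambda=(0001001000)$, $m_{11}=17$, $V_{11}=\langle(1\text{-}8),(1\text{-}4,9\text{-}12),(1,2,3,5,9,13,14,15),(6,7,16,17)\rangle$; 12. $\lambda=(0000001100)$, $m_{12}=17$, $V_{12}=\langle(1\text{-}8),(1\text{-}4,9\text{-}12),(1,2,3,5,9,10,11,13),(1,2,9,10,14\text{-}17)\rangle$; 13. $\lambda=(0110111100)$, $m_{13}=17$, $V_{13}=\langle(1\text{-}8),(1,2,9,10),(1,3,9,11),(4,5,12\text{-}17)\rangle$; 14. $\lambda=(0001001100)$, $m_{14}=13$, $V_{14}=\langle(1\text{-}8),(1\text{-}4,9\text{-}12),(1,2,3,5,9,10,11,13),(1,2,9,10)\rangle$; 15. $\lambda=(1001001100)$, $m_{15}=17$, $V_{15}=\langle(1\text{-}12),(1\text{-}4,13\text{-}16),(1,2,3,5,13,14,15,17),(1,2,13,14)\rangle$;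 16. $\lambda=(0001111100)$, $m_{16}=17$, $V_{16}=\langle(1\text{-}8),(1,2,9\text{-}14),(1,3,9\text{-}13,15),(4,5,16,17)\rangle$. **Theorem.** For each $i=1,\dots,16$: a loop $C_i^4$ as above exists, the four listed generators of $V_i$ are linearly independent, and for every such loop $C_i^4$ the code $V_i\subseteq K^{m_i}$ is a minimal representation of $C_i^4$. It is unique up to equivalence: every minimal representation of $C_i^4$ has degree $m_i$, and every representation of $C_i^4$ of degree $m_i$ is equivalent to $V_i$. -/

import Mathlib

/-! Doubly even binary codes, their code loops, and the sixteen nonassociative code loops of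
rank `4`, together with the list of codes representing them. -/

/-- A binary linear code of length `m`: a subspace of `𝔽₂ᵐ`. -/
abbrev BinaryCode (m : ℕ) : Type := Submodule (ZMod 2) (Fin m → ZMod 2)

namespace BinaryCode

variable {m : ℕ}

/-- All weights are divisible by `4`. (`hammingNorm v` is the number of nonzero coordinates.) -/
def IsDoublyEven (V : BinaryCode m) : Prop :=
  ∀ v ∈ V, 4 ∣ hammingNorm v

/-- A factor set on a code `V`. Here `v * w` is the coordinatewise product, whose support is the
intersection of the supports, so `hammingNorm (v * w)` is `|v ∩ w|`. For a doubly even code the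
divisions by `4` and by `2` are exact. -/
structure IsFactorSet (V : BinaryCode m) (φ : V → V → ℤˣ) : Prop where
  diag : ∀ v : V, φ v v = (-1) ^ (hammingNorm (v : Fin m → ZMod 2) / 4)
  symm : ∀ v w : V,
    φ v w = (-1) ^ (hammingNorm ((v : Fin m → ZMod 2) * (w : Fin m → ZMod 2)) / 2) * φ w v
  zero_left : ∀ v : V, φ 0 v = 1
  zero_right : ∀ v : V, φ v 0 = 1
  cocycle : ∀ v w u : V,
    φ (v + w) u = φ v (w + u) * φ v w * φ w u *
      (-1) ^ hammingNorm
        ((v : Fin m → ZMod 2) * (w : Fin m → ZMod 2) * (u : Fin m → ZMod 2))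

/-- Two codes of the same length are equivalent if a permutation of the coordinates carries one
onto the other. -/
def IsEquivalent (V W : BinaryCode m) : Prop :=
  ∃ e : Equiv.Perm (Fin m), V.map (LinearMap.funLeft (ZMod 2) (ZMod 2) e) = W

/-- The equivalence class of the coordinate `i`: all coordinates `j` such that every word of `V`
takes the same value at `i` and at `j`. -/
def coordClass (V : BinaryCode m) (i : Fin m) : Set (Fin m) :=
  {j | ∀ v ∈ V, v i = v j}

end BinaryCode

/-- The underlying set `{1, -1} × V` of the code loop `L(V)` built with the factor set `φ`. -/
@[ext]
structure CodeLoop {m : ℕ} (V : BinaryCode m) (φ : V → V → ℤˣ) where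
  sign : ℤˣ
  vec : V

namespace CodeLoop

variable {m : ℕ} {V : BinaryCode m} {φ : V → V → ℤˣ}

/-- `(± v) · (± w) = ± φ(v, w) (v + w)`. -/
instance : Mul (CodeLoop V φ) where
  mul x y := ⟨x.sign * y.sign * φ x.vec y.vec, x.vec + y.vec⟩

/-- Since `v · v = φ(v, v) 0`, the inverse of `± v` is `± φ(v, v) v`. -/
instance : Inv (CodeLoop V φ) where
  inv x := ⟨x.sign * φ x.vec x.vec, x.vec⟩

/-- The element `(-1)ᵏ` of the loop, that is, `((-1)ᵏ, 0)`. -/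
def signElt (V : BinaryCode m) (φ : V → V → ℤˣ) (k : ℕ) : CodeLoop V φ := ⟨(-1) ^ k, 0⟩

/-- The commutator `[u, v] = u⁻¹ v⁻¹ u v`. -/
def comm (u v : CodeLoop V φ) : CodeLoop V φ := (u⁻¹ * v⁻¹) * (u * v)

/-- The associator `(u, v, w) = ((u v) w) (u (v w))⁻¹`. -/
def assoc (u v w : CodeLoop V φ) : CodeLoop V φ := ((u * v) * w) * (u * (v * w))⁻¹

/-- The elements `a = x 0`, `b = x 1`, `c = x 2`, `d = x 3` have the characteristic vector
`(l 0, …, l 9)`, where the squares and commutators are read off from `l`, the associator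
`(a, b, c)` is `-1` and the associators `(a, b, d)`, `(a, c, d)`, `(b, c, d)` are `1`. -/
structure HasCharVector (x : Fin 4 → CodeLoop V φ) (l : Fin 10 → ℕ) : Prop where
  sq_a : x 0 * x 0 = signElt V φ (l 0)
  sq_b : x 1 * x 1 = signElt V φ (l 1)
  sq_c : x 2 * x 2 = signElt V φ (l 2)
  sq_d : x 3 * x 3 = signElt V φ (l 3)
  comm_ab : comm (x 0) (x 1) = signElt V φ (l 4)
  comm_ac : comm (x 0) (x 2) = signElt V φ (l 5)
  comm_ad : comm (x 0) (x 3) = signElt V φ (l 6)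
  comm_bc : comm (x 1) (x 2) = signElt V φ (l 7)
  comm_bd : comm (x 1) (x 3) = signElt V φ (l 8)
  comm_cd : comm (x 2) (x 3) = signElt V φ (l 9)
  assoc_abc : assoc (x 0) (x 1) (x 2) = signElt V φ 1
  assoc_abd : assoc (x 0) (x 1) (x 3) = signElt V φ 0
  assoc_acd : assoc (x 0) (x 2) (x 3) = signElt V φ 0
  assoc_bcd : assoc (x 1) (x 2) (x 3) = signElt V φ 0

end CodeLoop

/-- `L` is a code loop of rank `4` with characteristic vector `l`: it is isomorphic to some
`L(W)` with `W` doubly even of dimension `4`, and `L(W)` is generated by four elements that have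
the characteristic vector `l`. (`Subsemigroup` only asks for closure under the product; in a
finite loop such a nonempty subset is a subloop.) -/
def IsCodeLoopOfCharVector (L : Type*) [Mul L] (l : Fin 10 → ℕ) : Prop :=
  ∃ (n : ℕ) (W : BinaryCode n) (φ : W → W → ℤˣ),
    W.IsDoublyEven ∧ W.IsFactorSet φ ∧ Module.finrank (ZMod 2) W = 4 ∧
    Nonempty (L ≃* CodeLoop W φ) ∧
    ∃ x : Fin 4 → CodeLoop W φ,
      Subsemigroup.closure (Set.range x) = ⊤ ∧ CodeLoop.HasCharVector x l

/-- `V` is a representation of `L`, of degree its length `m`: `V` is doubly even and `L` is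
isomorphic to `L(V)`. -/
def IsRepresentation (L : Type*) [Mul L] {m : ℕ} (V : BinaryCode m) : Prop :=
  V.IsDoublyEven ∧ ∃ φ : V → V → ℤˣ, V.IsFactorSet φ ∧ Nonempty (L ≃* CodeLoop V φ)

/-- A reduced representation: every coordinate is used, and every equivalence class of
coordinates has fewer than `8` elements. -/
structure IsReducedRepresentation (L : Type*) [Mul L] {m : ℕ} (V : BinaryCode m) : Prop where
  isRepresentation : IsRepresentation L V
  support : ∀ i : Fin m, ∃ v ∈ V, v i ≠ 0
  card_lt : ∀ i : Fin m, (V.coordClass i).ncard < 8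

/-- A minimal representation: reduced, and of least degree among all representations of `L`
(reduced or not). -/
structure IsMinimalRepresentation (L : Type*) [Mul L] {m : ℕ} (V : BinaryCode m) : Prop where
  isReduced : IsReducedRepresentation L V
  degree_le : ∀ (n : ℕ) (W : BinaryCode n), IsRepresentation L W → m ≤ n

namespace RankFour

/-- The characteristic vectors of the sixteen nonassociative code loops of rank `4`
(the loop number `k` has index `k - 1`). -/
def charVector : Fin 16 → Fin 10 → ℕ :=
  ![![1, 1, 1, 0, 1, 1, 0, 1, 0, 0],
    ![0, 0, 0, 0, 0, 0, 0, 0, 0, 0],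
    ![0, 0, 0, 0, 1, 1, 0, 1, 0, 0],
    ![0, 0, 1, 0, 1, 0, 0, 0, 0, 0],
    ![0, 0, 0, 0, 0, 1, 0, 1, 0, 0],
    ![1, 1, 1, 1, 1, 1, 0, 1, 0, 0],
    ![0, 0, 0, 1, 0, 0, 0, 0, 0, 0],
    ![0, 0, 0, 0, 0, 0, 1, 0, 0, 0],
    ![0, 1, 0, 0, 0, 0, 1, 0, 0, 0],
    ![0, 0, 0, 1, 1, 1, 1, 0, 0, 0],
    ![0, 0, 0, 1, 0, 0, 1, 0, 0, 0],
    ![0, 0, 0, 0, 0, 0, 1, 1, 0, 0],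
    ![0, 1, 1, 0, 1, 1, 1, 1, 0, 0],
    ![0, 0, 0, 1, 0, 0, 1, 1, 0, 0],
    ![1, 0, 0, 1, 0, 0, 1, 1, 0, 0],
    ![0, 0, 0, 1, 1, 1, 1, 1, 0, 0]]

/-- The degrees of the sixteen codes. -/
def degree : Fin 16 → ℕ :=
  ![8, 14, 12, 18, 18, 11, 17, 17, 19, 19, 17, 17, 17, 13, 17, 17]

open Finset in
/-- The supports, as subsets of `{1, …, m}`, of the four listed generators of each code. -/
def genSupport : Fin 16 → Fin 4 → Finset ℕ :=
  ![![{1, 2, 3, 4}, {1, 2, 5, 6}, {1, 3, 5, 7}, Icc 1 8],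
    ![Icc 1 8, Icc 1 4 ∪ Icc 9 12, {1, 5, 6, 7, 9, 10, 11, 13}, {1, 2, 5, 8, 9, 12, 13, 14}],
    ![Icc 1 8, Icc 1 6 ∪ {9, 10}, {1, 2, 3, 4, 5, 7, 9, 11}, {1} ∪ Icc 6 12],
    ![Icc 1 8, Icc 1 6 ∪ {9, 10}, {1, 2, 3, 7, 9} ∪ Icc 11 17, {1, 4, 7, 8, 9, 10, 11, 18}],
    ![Icc 1 8, Icc 1 4 ∪ Icc 9 12, {1, 5, 9} ∪ Icc 13 17, {1, 2, 5, 6, 9, 10, 13, 18}],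
    ![{1, 2, 3, 4}, {1, 2, 5, 6}, {1, 3, 5, 7}, {8, 9, 10, 11}],
    ![Icc 1 8, Icc 1 4 ∪ Icc 9 12, {1, 5, 6, 7, 9, 10, 11, 13}, {14, 15, 16, 17}],
    ![Icc 1 8, Icc 1 4 ∪ Icc 9 12, {1, 2, 3, 5, 9, 13, 14, 15}, {1, 2, 10, 11, 13, 14, 16, 17}],
    ![Icc 1 8, Icc 1 4 ∪ Icc 9 16, {1, 5, 6, 7, 9, 10, 11, 17}, {5, 6, 9, 10, 12, 13, 18, 19}],
    ![Icc 1 8, {1, 2} ∪ Icc 9 14, {1, 3, 9, 10, 11, 15, 16, 17}, {4, 5, 18, 19}],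
    ![Icc 1 8, Icc 1 4 ∪ Icc 9 12, {1, 2, 3, 5, 9, 13, 14, 15}, {6, 7, 16, 17}],
    ![Icc 1 8, Icc 1 4 ∪ Icc 9 12, {1, 2, 3, 5, 9, 10, 11, 13}, {1, 2, 9, 10, 14, 15, 16, 17}],
    ![Icc 1 8, {1, 2, 9, 10}, {1, 3, 9, 11}, {4, 5} ∪ Icc 12 17],
    ![Icc 1 8, Icc 1 4 ∪ Icc 9 12, {1, 2, 3, 5, 9, 10, 11, 13}, {1, 2, 9, 10}],
    ![Icc 1 12, Icc 1 4 ∪ Icc 13 16, {1, 2, 3, 5, 13, 14, 15, 17}, {1, 2, 13, 14}],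
    ![Icc 1 8, {1, 2} ∪ Icc 9 14, {1, 3} ∪ Icc 9 13 ∪ {15}, {4, 5, 16, 17}]]

/-- The vector of `𝔽₂ᵐ` supported on `s ⊆ {1, …, m}`; the coordinate called `j` in the
`1`-based numbering is `⟨j - 1, _⟩ : Fin m`. -/
def vecOfSupport (m : ℕ) (s : Finset ℕ) : Fin m → ZMod 2 :=
  fun j => if (j : ℕ) + 1 ∈ s then 1 else 0

/-- The listed generators of the code number `i`. -/
def gen (i : Fin 16) (k : Fin 4) : Fin (degree i) → ZMod 2 :=
  vecOfSupport (degree i) (genSupport i k)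

/-- The sixteen codes `V₁, …, V₁₆`. -/
def code (i : Fin 16) : BinaryCode (degree i) :=
  Submodule.span (ZMod 2) (Set.range (gen i))

end RankFour

/-! For a doubly even code, let q(v) be the parity of |v|/4. The parities of |v ∩ w|/2 and |u ∩ v ∩
w| are the polarizations of q, so being a factor set is a condition on (V, q) alone, and factor sets
pull back along linear isomorphisms preserving q.

Squares, commutators and associators in L(V) record weights mod 8, pairwise intersections mod 4 and
triple intersections mod 2. An isomorphism fixes -1, which is an associator here. Hence every
representation of a loop with characteristic vector λ has a basis satisfying the congruences
`HasWeightType`. Conversely, these congruences determine q as a cubic form in the coordinates, so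
any independent vectors satisfying them span a representation; an explicit cubic exponent supplies a
factor set, and thus existence.

Up to a permutation of coordinates, four vectors amount to the multiplicities of the sixteen
patterns of values at a coordinate. The congruences are linear in these multiplicities and leave two
choices for their parities: either exactly the patterns 1 to 7 are odd, or exactly the patterns 8 to
15. Halving gives the same congruences in both cases, with total at most (m - 7)/2 ≤ 6, a range
small enough for a kernel-checked search. For each loop, the only solution of total at most m_i with
nonzero fourth vector is that of V_i, whose total is exactly m_i. This one computation gives both
the lower bound on the degree and uniqueness. -/

/-- The character `ℤ/2 → {1, -1}`. -/
def signChar (x : ZMod 2) : ℤˣ := (-1) ^ x.val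

theorem signChar_zero : signChar 0 = 1 := by decide

theorem signChar_add (x y : ZMod 2) : signChar (x + y) = signChar x * signChar y := by
  revert x y; decide

theorem signChar_injective : Function.Injective signChar := by
  intro x y; revert x y; decide

theorem neg_one_pow_eq_signChar (n : ℕ) : (-1 : ℤˣ) ^ n = signChar n := by
  rw [signChar, ZMod.val_natCast, ← Int.units_pow_eq_pow_mod_two]

theorem ZMod.two_natCast_eq_iff (a b : ℕ) : (a : ZMod 2) = b ↔ a % 2 = b % 2 :=
  ZMod.natCast_eq_natCast_iff' a b 2

/-! ### Weights of sums and intersections -/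

section HammingNorm

variable {m : ℕ}

theorem hammingNorm_eq_sum_val (v : Fin m → ZMod 2) : hammingNorm v = ∑ j, (v j).val := by
  rw [hammingNorm, Finset.card_filter]
  refine Finset.sum_congr rfl fun j _ => ?_
  generalize v j = x
  revert x; decide

/-- Coordinatewise inclusion and exclusion. It is the source of the parities of half and triple
intersections in a doubly even code. -/
theorem hammingNorm_add_two_mul (u v : Fin m → ZMod 2) :
    hammingNorm (u + v) + 2 * hammingNorm (u * v) = hammingNorm u + hammingNorm v := by
  simp only [hammingNorm_eq_sum_val, Finset.mul_sum, ← Finset.sum_add_distrib]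
  refine Finset.sum_congr rfl fun j _ => ?_
  simp only [Pi.add_apply, Pi.mul_apply]
  generalize u j = x
  generalize v j = y
  revert x y; decide

theorem mul_self_zmod_two (v : Fin m → ZMod 2) : v * v = v := by
  funext j
  simp only [Pi.mul_apply]
  generalize v j = x
  revert x; decide

end HammingNorm

/-! ### Factor sets in terms of the quarter weight -/

namespace BinaryCode

variable {m : ℕ} {V : BinaryCode m}

/-- The parity of `|v| / 4`. -/
def quarterWeight (v : V) : ZMod 2 := (hammingNorm (v : Fin m → ZMod 2) / 4 : ℕ)

theorem IsDoublyEven.two_dvd (hV : V.IsDoublyEven) (v w : V) :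
    2 ∣ hammingNorm ((v : Fin m → ZMod 2) * (w : Fin m → ZMod 2)) := by
  have h := hammingNorm_add_two_mul (v : Fin m → ZMod 2) w
  have h1 := hV v v.2
  have h2 := hV w w.2
  have h3 := hV _ (v + w).2
  rw [Submodule.coe_add] at h3
  omega

/-- Divide |v + w| + 2|v ∩ w| = |v| + |w| by 4: the first polarization of the quarter weight. -/
theorem IsDoublyEven.half_inter (hV : V.IsDoublyEven) (v w : V) :
    ((hammingNorm ((v : Fin m → ZMod 2) * (w : Fin m → ZMod 2)) / 2 : ℕ) : ZMod 2) =
      quarterWeight v + quarterWeight w + quarterWeight (v + w) := by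
  have h := hammingNorm_add_two_mul (v : Fin m → ZMod 2) w
  have h1 := hV v v.2
  have h2 := hV w w.2
  have h3 := hV _ (v + w).2
  simp only [quarterWeight]
  rw [← Nat.cast_add, ← Nat.cast_add, ZMod.two_natCast_eq_iff]
  rw [Submodule.coe_add] at h3 ⊢
  omega

/-- The second polarization: u ∩ w and v ∩ w have sum (u + v) ∩ w and intersection u ∩ v ∩ w, so
halving their weight identity reduces the claim to three half intersections. -/
theorem IsDoublyEven.triple_inter (hV : V.IsDoublyEven) (u v w : V) :
    ((hammingNorm ((u : Fin m → ZMod 2) * (v : Fin m → ZMod 2) * (w : Fin m → ZMod 2)) : ℕ) :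
      ZMod 2) =
      quarterWeight u + quarterWeight v + quarterWeight w + quarterWeight (u + v) +
        quarterWeight (v + w) + quarterWeight (u + w) + quarterWeight (u + v + w) := by
  have h := hammingNorm_add_two_mul ((u : Fin m → ZMod 2) * (w : Fin m → ZMod 2))
    ((v : Fin m → ZMod 2) * (w : Fin m → ZMod 2))
  have e : (u : Fin m → ZMod 2) * (w : Fin m → ZMod 2) *
      ((v : Fin m → ZMod 2) * (w : Fin m → ZMod 2)) = (u : Fin m → ZMod 2) * (v : Fin m → ZMod 2)
          * (w : Fin m → ZMod 2) := by
    rw [mul_mul_mul_comm, mul_self_zmod_two]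
  rw [e, ← add_mul, ← Submodule.coe_add] at h
  have h1 := hV.two_dvd (u + v) w
  have h2 := hV.two_dvd u w
  have h3 := hV.two_dvd v w
  have key : ((hammingNorm ((u : Fin m → ZMod 2) * (v : Fin m → ZMod 2) * (w : Fin m → ZMod 2)) :
      ℕ) : ZMod 2) =
      ((hammingNorm (((u + v : V) : Fin m → ZMod 2) * (w : Fin m → ZMod 2)) / 2 : ℕ) : ZMod 2) +
      ((hammingNorm ((u : Fin m → ZMod 2) * (w : Fin m → ZMod 2)) / 2 : ℕ) : ZMod 2) +
      ((hammingNorm ((v : Fin m → ZMod 2) * (w : Fin m → ZMod 2)) / 2 : ℕ) : ZMod 2) := by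
    rw [← Nat.cast_add, ← Nat.cast_add, ZMod.two_natCast_eq_iff]
    omega
  rw [key, hV.half_inter, hV.half_inter, hV.half_inter]
  have h2 : (2 : ZMod 2) = 0 := rfl
  linear_combination quarterWeight w * h2

/-- In a doubly even code the conditions on a factor set only depend on the parities of the
numbers `|v| / 4`. -/
theorem IsDoublyEven.isFactorSet_iff (hV : V.IsDoublyEven) (φ : V → V → ℤˣ) :
    V.IsFactorSet φ ↔
      (∀ v, φ v v = signChar (quarterWeight v)) ∧
      (∀ v w, φ v w = signChar (quarterWeight v + quarterWeight w + quarterWeight (v + w)) *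
        φ w v) ∧
      (∀ v, φ 0 v = 1) ∧ (∀ v, φ v 0 = 1) ∧
      ∀ v w u, φ (v + w) u = φ v (w + u) * φ v w * φ w u *
        signChar (quarterWeight v + quarterWeight w + quarterWeight u + quarterWeight (v + w) +
          quarterWeight (w + u) + quarterWeight (v + u) + quarterWeight (v + w + u)) := by
  simp only [← hV.half_inter, ← hV.triple_inter]
  simp only [quarterWeight, ← neg_one_pow_eq_signChar]
  exact ⟨fun h => ⟨h.1, h.2, h.3, h.4, h.5⟩, fun h => ⟨h.1, h.2.1, h.2.2.1, h.2.2.2.1, h.2.2.2.2⟩⟩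

/-- Factor sets are carried along linear isomorphisms that preserve the weights modulo `8`. -/
theorem IsFactorSet.comp_linearEquiv {n : ℕ} {W : BinaryCode n} (hV : V.IsDoublyEven)
    (hW : W.IsDoublyEven) {φ : W → W → ℤˣ} (hφ : W.IsFactorSet φ) (f : V ≃ₗ[ZMod 2] W)
    (hf : ∀ v, quarterWeight (f v) = quarterWeight v) :
    V.IsFactorSet fun v w => φ (f v) (f w) := by
  rw [hW.isFactorSet_iff] at hφ
  rw [hV.isFactorSet_iff]
  obtain ⟨h1, h2, h3, h4, h5⟩ := hφ
  refine ⟨fun v => ?_, fun v w => ?_, fun v => ?_, fun v => ?_, fun v w u => ?_⟩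
  · rw [h1, hf]
  · simpa only [← map_add, hf] using h2 (f v) (f w)
  · simpa using h3 (f v)
  · simpa using h4 (f v)
  · simpa only [← map_add, hf] using h5 (f v) (f w) (f u)

end BinaryCode

/-- Transport of a code loop along a linear isomorphism of the codes. -/
def CodeLoop.congr {m n : ℕ} {V : BinaryCode m} {W : BinaryCode n} (φ : W → W → ℤˣ)
    (f : V ≃ₗ[ZMod 2] W) : CodeLoop V (fun v w => φ (f v) (f w)) ≃* CodeLoop W φ where
  toFun x := ⟨x.sign, f x.vec⟩
  invFun x := ⟨x.sign, f.symm x.vec⟩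
  left_inv x := by ext1 <;> simp
  right_inv x := by ext1 <;> simp
  map_mul' x y := by
    apply CodeLoop.ext
    · rfl
    · exact map_add f x.vec y.vec

/-! ### Bounded search for solutions of triangular congruences -/

/-- The elements `k ≤ r` of `{0, …, 6}` that are congruent to `c` modulo `M`. -/
def residueChoices (r M c : ℕ) : List ℕ :=
  [0, 1, 2, 3, 4, 5, 6].filter fun k => Nat.ble k r && Nat.beq (k % M) (c % M)

theorem mem_residueChoices {r M c k : ℕ} (hr : r ≤ 6) (hk : k ≤ r) (hc : k % M = c % M) :
    k ∈ residueChoices r M c := by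
  rw [residueChoices, List.mem_filter, Bool.and_eq_true]
  refine ⟨?_, Nat.ble_eq_true_of_le hk, by simpa using hc⟩
  have : k ≤ 6 := hk.trans hr
  interval_cases k <;> simp

/-- The sum of the products of the entries of two lists. -/
def listDot : List ℕ → List ℕ → ℕ
  | x :: xs, y :: ys => x * y + listDot xs ys
  | _, _ => 0

/-- Backtracking over the lists of natural numbers with sum at most `B`, where each entry is
prescribed, modulo some `M`, by the entries chosen before it. -/
def congruenceSearch (leaf : List ℕ → Bool) : List (ℕ × ℕ × List ℕ) → ℕ → List ℕ → Bool
  | [], _, acc => leaf acc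
  | (M, c, mask) :: rest, B, acc =>
    (residueChoices B M (c + listDot mask acc)).all fun k =>
      congruenceSearch leaf rest (B - k) (k :: acc)

/-- The entries of the list `ks` satisfy the given congruences. -/
def SatisfiesCongruences : List (ℕ × ℕ × List ℕ) → List ℕ → List ℕ → Prop
  | [], _, ks => ks = []
  | _ :: _, _, [] => False
  | (M, c, mask) :: rest, acc, k :: ks =>
    k % M = (c + listDot mask acc) % M ∧ SatisfiesCongruences rest (k :: acc) ks

theorem congruenceSearch_sound {leaf : List ℕ → Bool} {steps : List (ℕ × ℕ × List ℕ)} {B : ℕ}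
    {acc ks : List ℕ} (h : congruenceSearch leaf steps B acc = true) (hB : B ≤ 6)
    (hs : ks.sum ≤ B) (hk : SatisfiesCongruences steps acc ks) :
    leaf (ks.reverse ++ acc) = true := by
  induction steps generalizing B acc ks with
  | nil =>
    obtain rfl : ks = [] := hk
    exact h
  | cons s rest ih =>
    obtain ⟨M, c, mask⟩ := s
    cases ks with
    | nil => exact hk.elim
    | cons k ks =>
      rw [List.sum_cons] at hs
      have := List.all_eq_true.1 h k (mem_residueChoices hB (by omega) hk.1)
      have := ih this (by omega) (by omega) hk.2
      simpa using this

/-- The congruences for the halved multiplicities of the coordinate patterns `1, …, 15` (the binary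
digits of a pattern are the values of four generators), taken in the order
`7, 15, 11, 3, 13, 5, 9, 1, 14, 6, 10, 12, 2, 4, 8`. The halved multiplicities of the patterns
containing two given generators have a prescribed sum modulo `2`, those of the patterns containing
a given generator a prescribed sum modulo `4`. -/
def patternSteps (a b c d ab ac ad bc bd cd : ℕ) : List (ℕ × ℕ × List ℕ) :=
  [(1, 0, []),
   (1, 0, []),
   (1, 0, []),
   (2, ab, [1, 1, 1]),
   (1, 0, []),
   (2, ac, [1, 0, 0, 1, 1]),
   (2, ad, [0, 1, 0, 1, 1]),
   (4, a, [3, 3, 3, 3, 3, 3, 3]),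
   (1, 0, []),
   (2, bc, [1, 0, 0, 0, 0, 0, 0, 1, 1]),
   (2, bd, [0, 1, 0, 0, 0, 0, 0, 1, 1]),
   (2, cd, [0, 0, 1, 0, 0, 0, 1, 0, 0, 1]),
   (4, b, [0, 3, 3, 3, 0, 0, 0, 0, 3, 3, 3, 3]),
   (4, c, [0, 3, 0, 3, 3, 0, 0, 3, 3, 0, 0, 3, 3]),
   (4, d, [0, 0, 3, 3, 0, 3, 0, 3, 0, 3, 0, 3, 3])]

/-- The multiplicities `n`, in the order reverse to that of `patternSteps`, have sum exceeding
`m`, or are the entries of `T`, or vanish at all patterns containing the last generator. -/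
def IsExcludedOrEq (m : ℕ) (T n : List ℕ) : Prop :=
  n.sum ≤ m → n = T ∨ listDot [1, 0, 0, 1, 1, 0, 1, 0, 1, 0, 1, 0, 1, 1, 0] n = 0

instance (m : ℕ) (T n : List ℕ) : Decidable (IsExcludedOrEq m T n) :=
  inferInstanceAs (Decidable (_ → _))

/-- Both possibilities for the parities of the multiplicities are covered by `IsExcludedOrEq`. -/
def patternLeaf (m : ℕ) (T ks : List ℕ) : Bool :=
  decide (IsExcludedOrEq m T (ks.zipWith (fun k e => 2 * k + e) [0, 1, 1, 0, 0, 1, 0, 1, 0, 1, 0,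
      1, 0, 0, 1])) &&
    decide (IsExcludedOrEq m T (ks.zipWith (fun k e => 2 * k + e) [1, 0, 0, 1, 1, 0, 1, 0, 1, 0,
        1, 0, 1, 1, 0]))

/-- In search order, the last pattern in each congruence is determined by the earlier ones, moved to
the other side with coefficient -1: this is 3 modulo 4 and 1 modulo 2. The bound on m keeps the
budget within the values 0 to 6 that the search tries. -/
theorem patternLeaf_of_congruences {m a b c d ab ac ad bc bd cd : ℕ} {T : List ℕ}
    (h : congruenceSearch (patternLeaf m T) (patternSteps a b c d ab ac ad bc bd cd)
      ((m - 7) / 2) [] = true) (hm : m ≤ 20)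
    {k1 k2 k3 k4 k5 k6 k7 k8 k9 k10 k11 k12 k13 k14 k15 : ℕ}
    (hs : k1 + k2 + k3 + k4 + k5 + k6 + k7 + k8 + k9 + k10 + k11 + k12 + k13 + k14 + k15 ≤ (m - 7)
        / 2)
    (ha : (k1 + k3 + k5 + k7 + k9 + k11 + k13 + k15) % 4 = a % 4)
    (hb : (k2 + k3 + k6 + k7 + k10 + k11 + k14 + k15) % 4 = b % 4)
    (hc : (k4 + k5 + k6 + k7 + k12 + k13 + k14 + k15) % 4 = c % 4)
    (hd : (k8 + k9 + k10 + k11 + k12 + k13 + k14 + k15) % 4 = d % 4)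
    (hab : (k3 + k7 + k11 + k15) % 2 = ab % 2)
    (hac : (k5 + k7 + k13 + k15) % 2 = ac % 2)
    (had : (k9 + k11 + k13 + k15) % 2 = ad % 2)
    (hbc : (k6 + k7 + k14 + k15) % 2 = bc % 2)
    (hbd : (k10 + k11 + k14 + k15) % 2 = bd % 2)
    (hcd : (k12 + k13 + k14 + k15) % 2 = cd % 2) :
    patternLeaf m T [k8, k4, k2, k12, k10, k6, k14, k1, k9, k5, k13, k3, k11, k15, k7] = true := by
  refine congruenceSearch_sound (ks := [k7, k15, k11, k3, k13, k5, k9, k1, k14, k6, k10, k12, k2,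
      k4, k8]) h (by omega) ?_ ?_
  · simp only [List.sum_cons, List.sum_nil]
    exact le_of_eq_of_le (by ring) hs
  · simp only [patternSteps, SatisfiesCongruences, listDot, Nat.mod_one, and_true, true_and]
    refine ⟨?_, ?_, ?_, ?_, ?_, ?_, ?_, ?_, ?_, ?_⟩ <;> clear h hs hm <;> omega

/-! ### Parities of the multiplicities and reduction to halves -/

theorem two_mul_half_add (n e : ℕ) (h : n % 2 = e) : 2 * (n / 2) + e = n := by omega

theorem parity_of_sum_four {x y z w t : ℕ} (h : (x + y + z + w) % 4 = 2 * t % 4) :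
    x % 2 = (y % 2 + z % 2 + w % 2) % 2 := by omega

theorem parity_of_sum_eight {x1 x2 x3 x4 x5 x6 x7 x8 t : ℕ}
    (h : (x1 + x2 + x3 + x4 + x5 + x6 + x7 + x8) % 8 = 4 * t % 8) :
    x1 % 2 = (x2 % 2 + x3 % 2 + x4 % 2 + x5 % 2 + x6 % 2 + x7 % 2 + x8 % 2) % 2 := by omega

theorem parity_of_sum_two {x y e : ℕ} (h : (x + y) % 2 = e) : x % 2 = (e + y % 2) % 2 := by omega

theorem sum_half_four {x y z w t e f g : ℕ} (h : (x + y + z + w) % 4 = 2 * t % 4) (hx : x % 2 = e)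
    (hy : y % 2 = e) (hz : z % 2 = f) (hw : w % 2 = f) (hg : g % 2 = (t + e + f) % 2) :
    (x / 2 + y / 2 + z / 2 + w / 2) % 2 = g % 2 := by omega

theorem sum_half_eight {x1 x2 x3 x4 x5 x6 x7 x8 t e f g : ℕ}
    (h : (x1 + x2 + x3 + x4 + x5 + x6 + x7 + x8) % 8 = 4 * t % 8)
    (h1 : x1 % 2 = e) (h2 : x2 % 2 = e) (h3 : x3 % 2 = e) (h4 : x4 % 2 = e)
    (h5 : x5 % 2 = f) (h6 : x6 % 2 = f) (h7 : x7 % 2 = f) (h8 : x8 % 2 = f)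
    (hg : g % 4 = (2 * t + 2 * e + 2 * f) % 4) :
    (x1 / 2 + x2 / 2 + x3 / 2 + x4 / 2 + x5 / 2 + x6 / 2 + x7 / 2 + x8 / 2) % 4 = g % 4 := by
  have e1 := two_mul_half_add _ _ h1
  have e2 := two_mul_half_add _ _ h2
  have e3 := two_mul_half_add _ _ h3
  have e4 := two_mul_half_add _ _ h4
  have e5 := two_mul_half_add _ _ h5
  have e6 := two_mul_half_add _ _ h6
  have e7 := two_mul_half_add _ _ h7
  have e8 := two_mul_half_add _ _ h8
  clear h1 h2 h3 h4 h5 h6 h7 h8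
  have hS : x1 + x2 + x3 + x4 + x5 + x6 + x7 + x8 = 2 * (x1 / 2 + x2 / 2 + x3 / 2 + x4 / 2 +
      x5 / 2 + x6 / 2 + x7 / 2 + x8 / 2) + 4 * e + 4 * f := by linarith
  rw [hS] at h
  generalize x1 / 2 + x2 / 2 + x3 / 2 + x4 / 2 + x5 / 2 + x6 / 2 + x7 / 2 + x8 / 2 = S at *
  clear e1 e2 e3 e4 e5 e6 e7 e8 hS
  omega

/-- At least seven entries are odd, seven if e = 1 and eight if f = 1, and each loses 1 on halving.
-/
theorem sum_half_le {m x1 x2 x3 x4 x5 x6 x7 x8 x9 x10 x11 x12 x13 x14 x15 e f : ℕ}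
    (hs : x1 + x2 + x3 + x4 + x5 + x6 + x7 + x8 + x9 + x10 + x11 + x12 + x13 + x14 + x15 ≤ m)
    (h1 : x1 % 2 = e) (h2 : x2 % 2 = e) (h3 : x3 % 2 = e) (h4 : x4 % 2 = e)
    (h5 : x5 % 2 = e) (h6 : x6 % 2 = e) (h7 : x7 % 2 = e) (h8 : x8 % 2 = f) (h9 : x9 % 2 = f)
    (h10 : x10 % 2 = f) (h11 : x11 % 2 = f) (h12 : x12 % 2 = f) (h13 : x13 % 2 = f)
    (h14 : x14 % 2 = f) (h15 : x15 % 2 = f) (hef : e + f = 1) :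
    x1 / 2 + x2 / 2 + x3 / 2 + x4 / 2 + x5 / 2 + x6 / 2 + x7 / 2 + x8 / 2 + x9 / 2 + x10 / 2 +
      x11 / 2 + x12 / 2 + x13 / 2 + x14 / 2 + x15 / 2 ≤ (m - 7) / 2 := by
  rw [Nat.le_div_iff_mul_le two_pos]
  refine Nat.le_sub_of_add_le (le_trans ?_ hs)
  have e1 := two_mul_half_add _ _ h1
  have e2 := two_mul_half_add _ _ h2
  have e3 := two_mul_half_add _ _ h3
  have e4 := two_mul_half_add _ _ h4
  have e5 := two_mul_half_add _ _ h5
  have e6 := two_mul_half_add _ _ h6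
  have e7 := two_mul_half_add _ _ h7
  have e8 := two_mul_half_add _ _ h8
  have e9 := two_mul_half_add _ _ h9
  have e10 := two_mul_half_add _ _ h10
  have e11 := two_mul_half_add _ _ h11
  have e12 := two_mul_half_add _ _ h12
  have e13 := two_mul_half_add _ _ h13
  have e14 := two_mul_half_add _ _ h14
  have e15 := two_mul_half_add _ _ h15
  linarith


/-- The parity of N 15 fixes all the others, through triples, then pairs, then single vectors. The
patterns 1 to 7 share one parity and 8 to 15 the opposite one. Conditions on a, b, c and their pairs
meet both blocks equally, whence the shifts by 2 and 1; those involving d meet only the second block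
and are not shifted. -/
theorem multiplicities_eq_of_congruences {m a b c d ab ac ad bc bd cd : ℕ} {T : List ℕ}
    (h : congruenceSearch (patternLeaf m T)
      (patternSteps (2 * a + 2) (2 * b + 2) (2 * c + 2) (2 * d) (ab + 1) (ac + 1) ad (bc + 1) bd cd)
      ((m - 7) / 2) [] = true) (hm : m ≤ 20) {N : Fin 16 → ℕ}
    (hs : N 1 + N 2 + N 3 + N 4 + N 5 + N 6 + N 7 + N 8 + N 9 + N 10 + N 11 + N 12 + N 13 + N 14 +
        N 15 ≤ m)
    (h0 : N 8 + N 9 + N 10 + N 11 + N 12 + N 13 + N 14 + N 15 ≠ 0)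
    (ha : (N 1 + N 3 + N 5 + N 7 + N 9 + N 11 + N 13 + N 15) % 8 = 4 * a % 8)
    (hb : (N 2 + N 3 + N 6 + N 7 + N 10 + N 11 + N 14 + N 15) % 8 = 4 * b % 8)
    (hc : (N 4 + N 5 + N 6 + N 7 + N 12 + N 13 + N 14 + N 15) % 8 = 4 * c % 8)
    (hd : (N 8 + N 9 + N 10 + N 11 + N 12 + N 13 + N 14 + N 15) % 8 = 4 * d % 8)
    (hab : (N 3 + N 7 + N 11 + N 15) % 4 = 2 * ab % 4)
    (hac : (N 5 + N 7 + N 13 + N 15) % 4 = 2 * ac % 4)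
    (had : (N 9 + N 11 + N 13 + N 15) % 4 = 2 * ad % 4)
    (hbc : (N 6 + N 7 + N 14 + N 15) % 4 = 2 * bc % 4)
    (hbd : (N 10 + N 11 + N 14 + N 15) % 4 = 2 * bd % 4)
    (hcd : (N 12 + N 13 + N 14 + N 15) % 4 = 2 * cd % 4)
    (habc : (N 7 + N 15) % 2 = 1)
    (habd : (N 11 + N 15) % 2 = 0)
    (hacd : (N 13 + N 15) % 2 = 0)
    (hbcd : (N 14 + N 15) % 2 = 0) :
    [N 8, N 4, N 2, N 12, N 10, N 6, N 14, N 1, N 9, N 5, N 13, N 3, N 11, N 15, N 7] = T := by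
  have key := patternLeaf_of_congruences h hm
    (k1 := N 1 / 2) (k2 := N 2 / 2) (k3 := N 3 / 2) (k4 := N 4 / 2) (k5 := N 5 / 2)
    (k6 := N 6 / 2) (k7 := N 7 / 2) (k8 := N 8 / 2) (k9 := N 9 / 2) (k10 := N 10 / 2)
    (k11 := N 11 / 2) (k12 := N 12 / 2) (k13 := N 13 / 2) (k14 := N 14 / 2) (k15 := N 15 / 2)
  simp only [patternLeaf, IsExcludedOrEq, List.zipWith, Bool.and_eq_true, decide_eq_true_eq,
    List.sum_cons, List.sum_nil, listDot] at key
  rcases Nat.mod_two_eq_zero_or_one (N 15) with p15 | p15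
  -- Patterns without d are odd, patterns with d even.
  · have p7 : N 7 % 2 = 1 := by
      rw [parity_of_sum_two habc, p15]
    have p11 : N 11 % 2 = 0 := by
      rw [parity_of_sum_two habd, p15]
    have p13 : N 13 % 2 = 0 := by
      rw [parity_of_sum_two hacd, p15]
    have p14 : N 14 % 2 = 0 := by
      rw [parity_of_sum_two hbcd, p15]
    have p3 : N 3 % 2 = 1 := by
      rw [parity_of_sum_four hab, p7, p11, p15]
    have p5 : N 5 % 2 = 1 := by
      rw [parity_of_sum_four hac, p7, p13, p15]
    have p9 : N 9 % 2 = 0 := by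
      rw [parity_of_sum_four had, p11, p13, p15]
    have p6 : N 6 % 2 = 1 := by
      rw [parity_of_sum_four hbc, p7, p14, p15]
    have p10 : N 10 % 2 = 0 := by
      rw [parity_of_sum_four hbd, p11, p14, p15]
    have p12 : N 12 % 2 = 0 := by
      rw [parity_of_sum_four hcd, p13, p14, p15]
    have p1 : N 1 % 2 = 1 := by
      rw [parity_of_sum_eight ha, p3, p5, p7, p9, p11, p13, p15]
    have p2 : N 2 % 2 = 1 := by
      rw [parity_of_sum_eight hb, p3, p6, p7, p10, p11, p14, p15]
    have p4 : N 4 % 2 = 1 := by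
      rw [parity_of_sum_eight hc, p5, p6, p7, p12, p13, p14, p15]
    have p8 : N 8 % 2 = 0 := by
      rw [parity_of_sum_eight hd, p9, p10, p11, p12, p13, p14, p15]
    replace key := (key (sum_half_le hs p1 p2 p3 p4 p5 p6 p7 p8 p9 p10 p11 p12 p13 p14 p15 rfl)
      (sum_half_eight ha p1 p3 p5 p7 p9 p11 p13 p15 (by clear * -; omega))
      (sum_half_eight hb p2 p3 p6 p7 p10 p11 p14 p15 (by clear * -; omega))
      (sum_half_eight hc p4 p5 p6 p7 p12 p13 p14 p15 (by clear * -; omega))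
      (sum_half_eight hd p8 p9 p10 p11 p12 p13 p14 p15 (by clear * -; omega))
      (sum_half_four hab p3 p7 p11 p15 (by clear * -; omega))
      (sum_half_four hac p5 p7 p13 p15 (by clear * -; omega))
      (sum_half_four had p9 p11 p13 p15 (by clear * -; omega))
      (sum_half_four hbc p6 p7 p14 p15 (by clear * -; omega))
      (sum_half_four hbd p10 p11 p14 p15 (by clear * -; omega))
      (sum_half_four hcd p12 p13 p14 p15 (by clear * -; omega))).1
    simp only [two_mul_half_add _ _ p1, two_mul_half_add _ _ p2, two_mul_half_add _ _ p3,
        two_mul_half_add _ _ p4, two_mul_half_add _ _ p5, two_mul_half_add _ _ p6,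
        two_mul_half_add _ _ p7, two_mul_half_add _ _ p8, two_mul_half_add _ _ p9,
        two_mul_half_add _ _ p10, two_mul_half_add _ _ p11, two_mul_half_add _ _ p12,
        two_mul_half_add _ _ p13, two_mul_half_add _ _ p14, two_mul_half_add _ _ p15] at key
    -- The other alternative would make the fourth vector zero.
    exact (key (le_of_eq_of_le (by ring) hs)).resolve_right
      fun e => h0 (Eq.trans (by ring) e)
  -- The opposite parities lead to the same congruences for the halves, so the same search result
  -- applies.
  · have p7 : N 7 % 2 = 0 := by
      rw [parity_of_sum_two habc, p15]
    have p11 : N 11 % 2 = 1 := by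
      rw [parity_of_sum_two habd, p15]
    have p13 : N 13 % 2 = 1 := by
      rw [parity_of_sum_two hacd, p15]
    have p14 : N 14 % 2 = 1 := by
      rw [parity_of_sum_two hbcd, p15]
    have p3 : N 3 % 2 = 0 := by
      rw [parity_of_sum_four hab, p7, p11, p15]
    have p5 : N 5 % 2 = 0 := by
      rw [parity_of_sum_four hac, p7, p13, p15]
    have p9 : N 9 % 2 = 1 := by
      rw [parity_of_sum_four had, p11, p13, p15]
    have p6 : N 6 % 2 = 0 := by
      rw [parity_of_sum_four hbc, p7, p14, p15]
    have p10 : N 10 % 2 = 1 := by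
      rw [parity_of_sum_four hbd, p11, p14, p15]
    have p12 : N 12 % 2 = 1 := by
      rw [parity_of_sum_four hcd, p13, p14, p15]
    have p1 : N 1 % 2 = 0 := by
      rw [parity_of_sum_eight ha, p3, p5, p7, p9, p11, p13, p15]
    have p2 : N 2 % 2 = 0 := by
      rw [parity_of_sum_eight hb, p3, p6, p7, p10, p11, p14, p15]
    have p4 : N 4 % 2 = 0 := by
      rw [parity_of_sum_eight hc, p5, p6, p7, p12, p13, p14, p15]
    have p8 : N 8 % 2 = 1 := by
      rw [parity_of_sum_eight hd, p9, p10, p11, p12, p13, p14, p15]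
    replace key := (key (sum_half_le hs p1 p2 p3 p4 p5 p6 p7 p8 p9 p10 p11 p12 p13 p14 p15 rfl)
      (sum_half_eight ha p1 p3 p5 p7 p9 p11 p13 p15 (by clear * -; omega))
      (sum_half_eight hb p2 p3 p6 p7 p10 p11 p14 p15 (by clear * -; omega))
      (sum_half_eight hc p4 p5 p6 p7 p12 p13 p14 p15 (by clear * -; omega))
      (sum_half_eight hd p8 p9 p10 p11 p12 p13 p14 p15 (by clear * -; omega))
      (sum_half_four hab p3 p7 p11 p15 (by clear * -; omega))
      (sum_half_four hac p5 p7 p13 p15 (by clear * -; omega))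
      (sum_half_four had p9 p11 p13 p15 (by clear * -; omega))
      (sum_half_four hbc p6 p7 p14 p15 (by clear * -; omega))
      (sum_half_four hbd p10 p11 p14 p15 (by clear * -; omega))
      (sum_half_four hcd p12 p13 p14 p15 (by clear * -; omega))).2
    simp only [two_mul_half_add _ _ p1, two_mul_half_add _ _ p2, two_mul_half_add _ _ p3,
        two_mul_half_add _ _ p4, two_mul_half_add _ _ p5, two_mul_half_add _ _ p6,
        two_mul_half_add _ _ p7, two_mul_half_add _ _ p8, two_mul_half_add _ _ p9,
        two_mul_half_add _ _ p10, two_mul_half_add _ _ p11, two_mul_half_add _ _ p12,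
        two_mul_half_add _ _ p13, two_mul_half_add _ _ p14, two_mul_half_add _ _ p15] at key
    exact (key (le_of_eq_of_le (by ring) hs)).resolve_right
      fun e => h0 (Eq.trans (by ring) e)

/-! ### The sixteen searches -/

namespace RankFour

/-- The multiplicities of the coordinate patterns of the sixteen codes, in the order reverse to
that of `patternSteps`. -/
def multiplicities : Fin 16 → List ℕ :=
  ![[1, 0, 0, 1, 1, 0, 1, 0, 1, 0, 1, 0, 1, 1, 0],
    [1, 0, 0, 1, 1, 2, 1, 0, 1, 2, 1, 2, 1, 1, 0],
    [1, 0, 0, 1, 1, 0, 1, 0, 1, 0, 1, 0, 1, 1, 4],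
    [1, 6, 0, 1, 1, 0, 1, 0, 1, 0, 1, 2, 1, 1, 2],
    [1, 4, 2, 1, 1, 0, 1, 2, 1, 0, 1, 2, 1, 1, 0],
    [4, 1, 1, 0, 0, 1, 0, 1, 0, 1, 0, 1, 0, 0, 1],
    [4, 1, 1, 0, 0, 3, 0, 1, 0, 3, 0, 3, 0, 0, 1],
    [2, 1, 1, 2, 2, 1, 0, 3, 0, 1, 0, 1, 0, 2, 1],
    [2, 1, 3, 0, 2, 1, 2, 1, 0, 1, 2, 3, 0, 0, 1],
    [2, 3, 3, 0, 0, 3, 0, 3, 2, 1, 0, 1, 0, 0, 1],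
    [2, 3, 3, 0, 0, 1, 0, 1, 2, 1, 0, 1, 0, 0, 3],
    [4, 1, 1, 0, 0, 1, 2, 3, 0, 1, 0, 1, 0, 2, 1],
    [6, 1, 1, 0, 0, 1, 0, 3, 2, 1, 0, 1, 0, 0, 1],
    [0, 1, 1, 0, 0, 1, 2, 3, 0, 1, 0, 1, 0, 2, 1],
    [0, 1, 1, 0, 0, 1, 2, 7, 0, 1, 0, 1, 0, 2, 1],
    [2, 1, 1, 0, 0, 5, 0, 3, 2, 1, 0, 1, 0, 0, 1]]

/-- The computational core: among totals up to the degree, only the listed multiplicities survive,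
apart from solutions in which the fourth vector vanishes. -/
theorem congruenceSearch_multiplicities (i : Fin 16) :
    congruenceSearch (patternLeaf (degree i) (multiplicities i))
      (patternSteps (2 * charVector i 0 + 2) (2 * charVector i 1 + 2) (2 * charVector i 2 + 2)
        (2 * charVector i 3) (charVector i 4 + 1) (charVector i 5 + 1) (charVector i 6)
        (charVector i 7 + 1) (charVector i 8) (charVector i 9))
      ((degree i - 7) / 2) [] = true := by
  revert i
  decide +kernel

theorem degree_le (i : Fin 16) : degree i ≤ 20 := by
  revert i
  decide

end RankFour

/-! ### Coordinate patterns and equivalence of codes -/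

section Patterns

variable {m n : ℕ}

/-- The number whose binary digits are the values `c 0, …, c 3`. -/
def bitPattern (c : Fin 4 → ZMod 2) : Fin 16 :=
  ⟨(c 0).val + 2 * (c 1).val + 4 * (c 2).val + 8 * (c 3).val, by
    have h0 := (c 0).val_lt
    have h1 := (c 1).val_lt
    have h2 := (c 2).val_lt
    have h3 := (c 3).val_lt
    omega⟩

theorem bitPattern_injective : Function.Injective bitPattern := by
  decide +kernel

/-- The number of coordinates with a given pattern of values of four vectors. -/
def patternMultiplicity (w : Fin 4 → Fin n → ZMod 2) (q : Fin 16) : ℕ :=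
  (Finset.univ.filter fun j => bitPattern (fun k => w k j) = q).card

theorem sum_patternMultiplicity (w : Fin 4 → Fin n → ZMod 2) :
    ∑ q, patternMultiplicity w q = n := by
  simpa [patternMultiplicity] using (Finset.card_eq_sum_card_fiberwise
    (s := (Finset.univ : Finset (Fin n))) (t := Finset.univ)
    (f := fun j => bitPattern fun k => w k j) (fun _ _ => by simp)).symm

theorem hammingNorm_eq_sum_multiplicity (w : Fin 4 → Fin n → ZMod 2) (v : Fin n → ZMod 2)
    (S : Finset (Fin 16)) (h : ∀ j, v j ≠ 0 ↔ bitPattern (fun k => w k j) ∈ S) :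
    hammingNorm v = ∑ q ∈ S, patternMultiplicity w q := by
  rw [hammingNorm, Finset.card_eq_sum_card_fiberwise (t := S)
    (f := fun j => bitPattern fun k => w k j)]
  · refine Finset.sum_congr rfl fun q hq => ?_
    rw [patternMultiplicity, Finset.filter_filter]
    congr 1
    refine Finset.filter_congr fun j _ => ⟨And.right, fun e => ⟨(h j).2 (e ▸ hq), e⟩⟩
  · intro j hj
    exact (h j).1 (by simpa using hj)

theorem hammingNorm_eq_sum_map (w : Fin 4 → Fin n → ZMod 2) (f : (Fin 4 → ZMod 2) → ZMod 2)
    (S : List (Fin 16)) (hS : S.Nodup) (h : ∀ c, f c ≠ 0 ↔ bitPattern c ∈ S) :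
    hammingNorm (fun j => f fun k => w k j) = (S.map (patternMultiplicity w)).sum := by
  rw [hammingNorm_eq_sum_multiplicity w _ S.toFinset fun j => by rw [List.mem_toFinset, h],
    List.sum_toFinset _ hS]

/-- Vectors with the same multiplicities of patterns differ by a permutation of coordinates. -/
theorem exists_perm_of_multiplicity_eq {w w' : Fin 4 → Fin n → ZMod 2}
    (h : patternMultiplicity w = patternMultiplicity w') :
    ∃ e : Equiv.Perm (Fin n), ∀ k, w k ∘ e = w' k := by
  have hf (q : Fin 16) : Nonempty ({j // bitPattern (fun k => w' k j) = q} ≃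
      {j // bitPattern (fun k => w k j) = q}) := by
    refine ⟨Fintype.equivOfCardEq ?_⟩
    rw [Fintype.card_subtype, Fintype.card_subtype]
    exact (congrFun h q).symm
  let F := fun q => (hf q).some
  -- Glue bijections between the sets of coordinates having the same pattern.
  refine ⟨((Equiv.sigmaFiberEquiv fun j => bitPattern fun k => w' k j).symm.trans
    (Equiv.sigmaCongrRight F)).trans (Equiv.sigmaFiberEquiv fun j => bitPattern fun k => w k j),
    fun k => funext fun j => ?_⟩
  exact congrFun (bitPattern_injective (F _ ⟨j, rfl⟩).2) k

theorem BinaryCode.isEquivalent_of_multiplicity_eq {V W : BinaryCode n}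
    {w w' : Fin 4 → Fin n → ZMod 2} (hV : Submodule.span (ZMod 2) (Set.range w) = V)
    (hW : Submodule.span (ZMod 2) (Set.range w') = W) (h : patternMultiplicity w =
        patternMultiplicity w') :
    V.IsEquivalent W := by
  obtain ⟨e, he⟩ := exists_perm_of_multiplicity_eq h
  refine ⟨e, ?_⟩
  rw [← hV, ← hW, Submodule.map_span, ← Set.range_comp]
  congr 2
  funext k
  exact he k

end Patterns

/-! ### Weight congruences for a basis -/

/-- The weights and intersections of four vectors correspond to the characteristic vector `l`
of a code loop with `(a, b, c) = -1`. -/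
structure HasWeightType {n : ℕ} (w : Fin 4 → Fin n → ZMod 2) (l : Fin 10 → ℕ) : Prop where
  a : hammingNorm (w 0) % 8 = 4 * l 0 % 8
  b : hammingNorm (w 1) % 8 = 4 * l 1 % 8
  c : hammingNorm (w 2) % 8 = 4 * l 2 % 8
  d : hammingNorm (w 3) % 8 = 4 * l 3 % 8
  ab : hammingNorm (w 0 * w 1) % 4 = 2 * l 4 % 4
  ac : hammingNorm (w 0 * w 2) % 4 = 2 * l 5 % 4
  ad : hammingNorm (w 0 * w 3) % 4 = 2 * l 6 % 4
  bc : hammingNorm (w 1 * w 2) % 4 = 2 * l 7 % 4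
  bd : hammingNorm (w 1 * w 3) % 4 = 2 * l 8 % 4
  cd : hammingNorm (w 2 * w 3) % 4 = 2 * l 9 % 4
  abc : hammingNorm (w 0 * w 1 * w 2) % 2 = 1
  abd : hammingNorm (w 0 * w 1 * w 3) % 2 = 0
  acd : hammingNorm (w 0 * w 2 * w 3) % 2 = 0
  bcd : hammingNorm (w 1 * w 2 * w 3) % 2 = 0

section WeightType

variable {n : ℕ} {w : Fin 4 → Fin n → ZMod 2} {l : Fin 10 → ℕ}

/-- Each weight is a sum of multiplicities over the patterns with the relevant bits set. Allowing n
≤ m, not just n = m, lets the same statement exclude smaller lengths. -/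
theorem HasWeightType.multiplicity_eq (hw : HasWeightType w l) (h3 : w 3 ≠ 0) {m : ℕ}
    (hm : m ≤ 20) (hn : n ≤ m) {T : List ℕ}
    (hT : congruenceSearch (patternLeaf m T)
      (patternSteps (2 * l 0 + 2) (2 * l 1 + 2) (2 * l 2 + 2) (2 * l 3) (l 4 + 1) (l 5 + 1) (l 6)
        (l 7 + 1) (l 8) (l 9)) ((m - 7) / 2) [] = true) :
    [8, 4, 2, 12, 10, 6, 14, 1, 9, 5, 13, 3, 11, 15, 7].map (patternMultiplicity w) = T := by
  obtain ⟨ha, hb, hc, hd, hab, hac, had, hbc, hbd, hcd, habc, habd, hacd, hbcd⟩ := hw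
  have hne := hammingNorm_ne_zero_iff.2 h3
  have ea : hammingNorm (w 0) = _ := hammingNorm_eq_sum_map w
    (fun c => c 0) [1, 3, 5, 7, 9, 11, 13, 15] (by decide) (by decide +kernel)
  have eb : hammingNorm (w 1) = _ := hammingNorm_eq_sum_map w
    (fun c => c 1) [2, 3, 6, 7, 10, 11, 14, 15] (by decide) (by decide +kernel)
  have ec : hammingNorm (w 2) = _ := hammingNorm_eq_sum_map w
    (fun c => c 2) [4, 5, 6, 7, 12, 13, 14, 15] (by decide) (by decide +kernel)
  have ed : hammingNorm (w 3) = _ := hammingNorm_eq_sum_map w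
    (fun c => c 3) [8, 9, 10, 11, 12, 13, 14, 15] (by decide) (by decide +kernel)
  have eab : hammingNorm (w 0 * w 1) = _ := hammingNorm_eq_sum_map w
    (fun c => c 0 * c 1) [3, 7, 11, 15] (by decide) (by decide +kernel)
  have eac : hammingNorm (w 0 * w 2) = _ := hammingNorm_eq_sum_map w
    (fun c => c 0 * c 2) [5, 7, 13, 15] (by decide) (by decide +kernel)
  have ead : hammingNorm (w 0 * w 3) = _ := hammingNorm_eq_sum_map w
    (fun c => c 0 * c 3) [9, 11, 13, 15] (by decide) (by decide +kernel)
  have ebc : hammingNorm (w 1 * w 2) = _ := hammingNorm_eq_sum_map w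
    (fun c => c 1 * c 2) [6, 7, 14, 15] (by decide) (by decide +kernel)
  have ebd : hammingNorm (w 1 * w 3) = _ := hammingNorm_eq_sum_map w
    (fun c => c 1 * c 3) [10, 11, 14, 15] (by decide) (by decide +kernel)
  have ecd : hammingNorm (w 2 * w 3) = _ := hammingNorm_eq_sum_map w
    (fun c => c 2 * c 3) [12, 13, 14, 15] (by decide) (by decide +kernel)
  have eabc : hammingNorm (w 0 * w 1 * w 2) = _ := hammingNorm_eq_sum_map w
    (fun c => c 0 * c 1 * c 2) [7, 15] (by decide) (by decide +kernel)
  have eabd : hammingNorm (w 0 * w 1 * w 3) = _ := hammingNorm_eq_sum_map w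
    (fun c => c 0 * c 1 * c 3) [11, 15] (by decide) (by decide +kernel)
  have eacd : hammingNorm (w 0 * w 2 * w 3) = _ := hammingNorm_eq_sum_map w
    (fun c => c 0 * c 2 * c 3) [13, 15] (by decide) (by decide +kernel)
  have ebcd : hammingNorm (w 1 * w 2 * w 3) = _ := hammingNorm_eq_sum_map w
    (fun c => c 1 * c 2 * c 3) [14, 15] (by decide) (by decide +kernel)
  rw [ea] at ha
  rw [eb] at hb
  rw [ec] at hc
  rw [ed] at hd
  rw [eab] at hab
  rw [eac] at hac
  rw [ead] at had
  rw [ebc] at hbc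
  rw [ebd] at hbd
  rw [ecd] at hcd
  rw [eabc] at habc
  rw [eabd] at habd
  rw [eacd] at hacd
  rw [ebcd] at hbcd
  rw [ed] at hne
  clear ea eb ec ed eab eac ead ebc ebd ecd eabc eabd eacd ebcd
  simp only [List.map_cons, List.map_nil, List.sum_cons, List.sum_nil, add_zero, ← add_assoc] at *
  refine multiplicities_eq_of_congruences hT hm ?_ hne ha hb hc hd hab hac had hbc hbd hcd
    habc habd hacd hbcd
  refine le_trans ?_ hn
  conv_rhs => rw [← sum_patternMultiplicity w]
  simp only [Fin.sum_univ_succ, Fin.sum_univ_zero]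
  simp
  omega

end WeightType

/-! ### The cubic form of a code and an explicit factor set -/

section WeightForm

variable {n : ℕ} {w : Fin 4 → Fin n → ZMod 2} {l : Fin 10 → ℕ}

theorem ZMod.two_val_add (x y : ZMod 2) :
    (((x + y).val : ℕ) : ℤ) = x.val + y.val - 2 * (x.val * y.val) := by
  revert x y; decide

theorem ZMod.two_val_mul (x y : ZMod 2) : (((x * y).val : ℕ) : ℤ) = x.val * y.val := by
  revert x y; decide

/-- Inclusion and exclusion for the weights of the linear combinations of four vectors. -/
theorem hammingNorm_linearCombination (w : Fin 4 → Fin n → ZMod 2) (c : Fin 4 → ZMod 2) :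
    (hammingNorm (∑ k, c k • w k) : ℤ) =
      (c 0).val * hammingNorm (w 0) + (c 1).val * hammingNorm (w 1) +
      (c 2).val * hammingNorm (w 2) + (c 3).val * hammingNorm (w 3) -
      2 * ((c 0).val * (c 1).val * hammingNorm (w 0 * w 1) +
        (c 0).val * (c 2).val * hammingNorm (w 0 * w 2) +
        (c 0).val * (c 3).val * hammingNorm (w 0 * w 3) +
        (c 1).val * (c 2).val * hammingNorm (w 1 * w 2) +
        (c 1).val * (c 3).val * hammingNorm (w 1 * w 3) +
        (c 2).val * (c 3).val * hammingNorm (w 2 * w 3)) +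
      4 * ((c 0).val * (c 1).val * (c 2).val * hammingNorm (w 0 * w 1 * w 2) +
        (c 0).val * (c 1).val * (c 3).val * hammingNorm (w 0 * w 1 * w 3) +
        (c 0).val * (c 2).val * (c 3).val * hammingNorm (w 0 * w 2 * w 3) +
        (c 1).val * (c 2).val * (c 3).val * hammingNorm (w 1 * w 2 * w 3)) -
      8 * ((c 0).val * (c 1).val * (c 2).val * (c 3).val *
        hammingNorm (w 0 * w 1 * w 2 * w 3)) := by
  simp only [hammingNorm_eq_sum_val, Nat.cast_sum, Finset.mul_sum, ← Finset.sum_add_distrib,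
    ← Finset.sum_sub_distrib]
  refine Finset.sum_congr rfl fun j _ => ?_
  simp only [Fin.sum_univ_four, Pi.add_apply, Pi.smul_apply, Pi.mul_apply, smul_eq_mul,
    ZMod.two_val_add, ZMod.two_val_mul]
  ring

/-- The cubic form on `𝔽₂⁴` whose value at a word is the parity of a quarter of its weight. -/
def weightForm (l : Fin 10 → ℕ) (c : Fin 4 → ZMod 2) : ZMod 2 :=
  l 0 * c 0 + l 1 * c 1 + l 2 * c 2 + l 3 * c 3 + l 4 * (c 0 * c 1) + l 5 * (c 0 * c 2) +
    l 6 * (c 0 * c 3) + l 7 * (c 1 * c 2) + l 8 * (c 1 * c 3) + l 9 * (c 2 * c 3) +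
    c 0 * c 1 * c 2

/-- Inclusion and exclusion modulo 8: the quadruple intersection has coefficient 8 and drops out,
and the sign of the pair terms is immaterial since -4 ≡ 4. The witness p is the cubic form evaluated
in ℕ. -/
theorem HasWeightType.exists_hammingNorm_eq (hw : HasWeightType w l) (c : Fin 4 → ZMod 2) :
    ∃ p : ℕ, hammingNorm (∑ k, c k • w k) % 8 = 4 * p % 8 ∧ (p : ZMod 2) = weightForm l c := by
  refine ⟨l 0 * (c 0).val + l 1 * (c 1).val + l 2 * (c 2).val + l 3 * (c 3).val +
    l 4 * ((c 0).val * (c 1).val) + l 5 * ((c 0).val * (c 2).val) +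
    l 6 * ((c 0).val * (c 3).val) + l 7 * ((c 1).val * (c 2).val) +
    l 8 * ((c 1).val * (c 3).val) + l 9 * ((c 2).val * (c 3).val) +
    (c 0).val * (c 1).val * (c 2).val, ?_, ?_⟩
  · obtain ⟨ha, hb, hc, hd, hab, hac, had, hbc, hbd, hcd, habc, habd, hacd, hbcd⟩ := hw
    have mod_eight (x t : ℕ) (h : x % 8 = 4 * t % 8) : ∃ z : ℤ, (x : ℤ) = 4 * t + 8 * z :=
      ⟨((x : ℤ) - 4 * t) / 8, by omega⟩
    have mod_four (x t : ℕ) (h : x % 4 = 2 * t % 4) : ∃ z : ℤ, (x : ℤ) = 2 * t + 4 * z :=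
      ⟨((x : ℤ) - 2 * t) / 4, by omega⟩
    have mod_two (x t : ℕ) (h : x % 2 = t) : ∃ z : ℤ, (x : ℤ) = t + 2 * z :=
      ⟨((x : ℤ) - t) / 2, by omega⟩
    obtain ⟨za, ha⟩ := mod_eight _ _ ha
    obtain ⟨zb, hb⟩ := mod_eight _ _ hb
    obtain ⟨zc, hc⟩ := mod_eight _ _ hc
    obtain ⟨zd, hd⟩ := mod_eight _ _ hd
    obtain ⟨zab, hab⟩ := mod_four _ _ hab
    obtain ⟨zac, hac⟩ := mod_four _ _ hac
    obtain ⟨zad, had⟩ := mod_four _ _ had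
    obtain ⟨zbc, hbc⟩ := mod_four _ _ hbc
    obtain ⟨zbd, hbd⟩ := mod_four _ _ hbd
    obtain ⟨zcd, hcd⟩ := mod_four _ _ hcd
    obtain ⟨zabc, habc⟩ := mod_two _ _ habc
    obtain ⟨zabd, habd⟩ := mod_two _ _ habd
    obtain ⟨zacd, hacd⟩ := mod_two _ _ hacd
    obtain ⟨zbcd, hbcd⟩ := mod_two _ _ hbcd
    rw [← Int.natCast_inj]
    push_cast
    rw [hammingNorm_linearCombination, ha, hb, hc, hd, hab, hac, had, hbc, hbd, hcd, habc, habd,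
      hacd, hbcd]
    generalize ((c 0).val : ℤ) = x0
    generalize ((c 1).val : ℤ) = x1
    generalize ((c 2).val : ℤ) = x2
    generalize ((c 3).val : ℤ) = x3
    -- The extra `l 4`, …, `l 9` arise from replacing -4 by 4 in the pair terms, a change of 8 each.
    refine Int.ModEq.symm (Int.modEq_iff_dvd.2 ⟨x0 * za + x1 * zb + x2 * zc + x3 * zd -
      x0 * x1 * (zab + l 4) - x0 * x2 * (zac + l 5) - x0 * x3 * (zad + l 6) -
      x1 * x2 * (zbc + l 7) - x1 * x3 * (zbd + l 8) - x2 * x3 * (zcd + l 9) +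
      x0 * x1 * x2 * zabc + x0 * x1 * x3 * zabd + x0 * x2 * x3 * zacd + x1 * x2 * x3 * zbcd -
      x0 * x1 * x2 * x3 * hammingNorm (w 0 * w 1 * w 2 * w 3), ?_⟩)
    push_cast
    ring
  · simp only [weightForm, Nat.cast_add, Nat.cast_mul, ZMod.natCast_val, ZMod.cast_id', id_eq]

variable {V : BinaryCode n}

/-- The coordinates of a code of dimension `4` with respect to a basis. -/
noncomputable def basisEquiv (hw : LinearIndependent (ZMod 2) w)
    (hV : Submodule.span (ZMod 2) (Set.range w) = V) : (Fin 4 → ZMod 2) ≃ₗ[ZMod 2] V :=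
  (Module.Basis.span hw).equivFun.symm.trans (LinearEquiv.ofEq _ _ hV)

theorem coe_basisEquiv (hw : LinearIndependent (ZMod 2) w)
    (hV : Submodule.span (ZMod 2) (Set.range w) = V) (c : Fin 4 → ZMod 2) :
    (basisEquiv hw hV c : Fin n → ZMod 2) = ∑ k, c k • w k := by
  simp [basisEquiv, Module.Basis.equivFun_symm_apply, Module.Basis.span_apply]

theorem HasWeightType.isDoublyEven (h : HasWeightType w l) (hw : LinearIndependent (ZMod 2) w)
    (hV : Submodule.span (ZMod 2) (Set.range w) = V) : V.IsDoublyEven := by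
  intro v hv
  obtain ⟨c, hc⟩ := (basisEquiv hw hV).surjective ⟨v, hv⟩
  obtain ⟨p, hp, -⟩ := h.exists_hammingNorm_eq c
  rw [← coe_basisEquiv hw hV, hc] at hp
  dsimp only at hp
  omega

theorem HasWeightType.quarterWeight_basisEquiv (h : HasWeightType w l)
    (hw : LinearIndependent (ZMod 2) w) (hV : Submodule.span (ZMod 2) (Set.range w) = V)
    (c : Fin 4 → ZMod 2) : BinaryCode.quarterWeight (basisEquiv hw hV c) = weightForm l c := by
  obtain ⟨p, hp, e⟩ := h.exists_hammingNorm_eq c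
  rw [← e, BinaryCode.quarterWeight, coe_basisEquiv, ZMod.two_natCast_eq_iff]
  omega

/-- The exponent of a factor set with the associators `(a, b, c) = -1` and
`(a, b, d) = (a, c, d) = (b, c, d) = 1`. -/
def factorForm (l : Fin 10 → ℕ) (c d : Fin 4 → ZMod 2) : ZMod 2 :=
  l 0 * (c 0 * d 0) + l 1 * (c 1 * d 1) + l 2 * (c 2 * d 2) + l 3 * (c 3 * d 3) +
    l 4 * (c 0 * d 1) + l 5 * (c 0 * d 2) + l 6 * (c 0 * d 3) + l 7 * (c 1 * d 2) +
    l 8 * (c 1 * d 3) + l 9 * (c 2 * d 3) +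
    d 0 * c 1 * c 2 + c 0 * d 1 * c 2 + c 0 * c 1 * d 2

theorem ZMod.two_mul_self (x : ZMod 2) : x * x = x := by
  revert x; decide

theorem factorForm_self (l : Fin 10 → ℕ) (c : Fin 4 → ZMod 2) :
    factorForm l c c = weightForm l c := by
  have h2 : (2 : ZMod 2) = 0 := rfl
  simp only [factorForm, weightForm, ZMod.two_mul_self]
  linear_combination c 0 * c 1 * c 2 * h2

theorem factorForm_comm (l : Fin 10 → ℕ) (c d : Fin 4 → ZMod 2) :
    factorForm l c d =
      weightForm l c + weightForm l d + weightForm l (c + d) + factorForm l d c := by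
  simp only [factorForm, weightForm, Pi.add_apply]
  ring_nf
  reduce_mod_char

/-- The exponent is additive in its second argument. In the first, its failure to be additive comes
from the cubic terms and is the trilinear polarization of c₀c₁c₂, which is the bracketed sum. -/
theorem factorForm_cocycle (l : Fin 10 → ℕ) (c d e : Fin 4 → ZMod 2) :
    factorForm l (c + d) e = factorForm l c (d + e) + factorForm l c d + factorForm l d e +
      (weightForm l c + weightForm l d + weightForm l e + weightForm l (c + d) +
        weightForm l (d + e) + weightForm l (c + e) + weightForm l (c + d + e)) := by
  simp only [factorForm, weightForm, Pi.add_apply]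
  ring_nf
  reduce_mod_char

theorem HasWeightType.isFactorSet (h : HasWeightType w l)
    (hw : LinearIndependent (ZMod 2) w) (hV : Submodule.span (ZMod 2) (Set.range w) = V) :
    V.IsFactorSet fun u v =>
      signChar (factorForm l ((basisEquiv hw hV).symm u) ((basisEquiv hw hV).symm v)) := by
  have hq (v : V) : BinaryCode.quarterWeight v = weightForm l ((basisEquiv hw hV).symm v) := by
    rw [← h.quarterWeight_basisEquiv hw hV, LinearEquiv.apply_symm_apply]
  rw [(h.isDoublyEven hw hV).isFactorSet_iff]
  simp only [hq, map_add, map_zero, ← signChar_add]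
  refine ⟨fun v => ?_, fun v w => ?_, fun v => ?_, fun v => ?_, fun v w u => ?_⟩
  · rw [factorForm_self]
  · rw [factorForm_comm]
  · simp [factorForm, signChar_zero]
  · simp [factorForm, signChar_zero]
  · rw [factorForm_cocycle]

end WeightForm

/-! ### Squares, commutators and associators; isomorphisms of code loops -/

namespace CodeLoop

variable {m n : ℕ} {V : BinaryCode m} {φ : V → V → ℤˣ} {W : BinaryCode n} {ψ : W → W → ℤˣ}

theorem mul_sign (x y : CodeLoop V φ) :
    (x * y).sign = x.sign * y.sign * φ x.vec y.vec := rfl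

theorem mul_vec (x y : CodeLoop V φ) : (x * y).vec = x.vec + y.vec := rfl

theorem inv_sign (x : CodeLoop V φ) : x⁻¹.sign = x.sign * φ x.vec x.vec := rfl

theorem inv_vec (x : CodeLoop V φ) : x⁻¹.vec = x.vec := rfl

theorem signElt_sign (k : ℕ) : (signElt V φ k).sign = (-1) ^ k := rfl

theorem signElt_vec (k : ℕ) : (signElt V φ k).vec = 0 := rfl

theorem signElt_eq_iff {j k : ℕ} : signElt V φ j = signElt V φ k ↔ j % 2 = k % 2 := by
  rw [CodeLoop.ext_iff, signElt_sign, signElt_sign, signElt_vec, signElt_vec,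
    neg_one_pow_eq_signChar, neg_one_pow_eq_signChar, signChar_injective.eq_iff,
    ZMod.two_natCast_eq_iff]
  simp

theorem vec_add_self (v : V) : v + v = 0 := ZModModule.add_self v

theorem units_mul_self (s : ℤˣ) : s * s = 1 := Int.units_mul_self s

theorem mul_self_eq (hφ : V.IsFactorSet φ) (x : CodeLoop V φ) :
    x * x = signElt V φ (hammingNorm (x.vec : Fin m → ZMod 2) / 4) := by
  ext1
  · rw [mul_sign, hφ.diag, units_mul_self, one_mul, signElt_sign]
  · exact vec_add_self _

/-- All signs occur twice except the diagonal values of φ at the two vectors and their sum, whose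
product is given by `half_inter`. -/
theorem comm_eq (hV : V.IsDoublyEven) (hφ : V.IsFactorSet φ) (x y : CodeLoop V φ) :
    comm x y = signElt V φ
      (hammingNorm ((x.vec : Fin m → ZMod 2) * (y.vec : Fin m → ZMod 2)) / 2) := by
  ext1
  · have h1 := ((hV.isFactorSet_iff φ).1 hφ).1
    rw [comm, mul_sign, mul_sign, mul_sign, mul_vec, mul_vec, inv_sign, inv_sign, inv_vec, inv_vec,
      signElt_sign, neg_one_pow_eq_signChar, hV.half_inter, signChar_add, signChar_add,
      ← h1, ← h1, ← h1]
    calc _ = (x.sign * x.sign) * (y.sign * y.sign) * (φ x.vec y.vec * φ x.vec y.vec) *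
        (φ x.vec x.vec * φ y.vec y.vec * φ (x.vec + y.vec) (x.vec + y.vec)) := by ac_rfl
      _ = _ := by simp only [units_mul_self, one_mul]
  · exact vec_add_self _

theorem assoc_eq (hφ : V.IsFactorSet φ) (x y z : CodeLoop V φ) :
    assoc x y z = signElt V φ
      (hammingNorm ((x.vec : Fin m → ZMod 2) * (y.vec : Fin m → ZMod 2) *
        (z.vec : Fin m → ZMod 2))) := by
  ext1
  · simp only [assoc, mul_sign, inv_sign, mul_vec, inv_vec, signElt_sign]
    rw [add_assoc x.vec y.vec z.vec, hφ.cocycle x.vec y.vec z.vec]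
    set e : ℤˣ := (-1) ^ hammingNorm ((x.vec : Fin m → ZMod 2) * (y.vec : Fin m → ZMod 2) *
        (z.vec : Fin m → ZMod 2))
    set t := φ (x.vec + (y.vec + z.vec)) (x.vec + (y.vec + z.vec))
    calc _ = (x.sign * x.sign) * (y.sign * y.sign) * (z.sign * z.sign) *
        (φ x.vec y.vec * φ x.vec y.vec) * (φ y.vec z.vec * φ y.vec z.vec) *
        (φ x.vec (y.vec + z.vec) * φ x.vec (y.vec + z.vec)) * (t * t) * e := by ac_rfl
      _ = _ := by simp only [units_mul_self, one_mul]
  · change x.vec + y.vec + z.vec + (x.vec + (y.vec + z.vec)) = 0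
    rw [add_assoc x.vec y.vec z.vec, vec_add_self]

/-- The identity is the only idempotent, so a purely multiplicative isomorphism preserves it, and
with it inverses, commutators and associators. -/
theorem eq_signElt_zero_of_mul_self (hφ : V.IsFactorSet φ) {x : CodeLoop V φ} (h : x * x = x) :
    x = signElt V φ 0 := by
  have hv : x.vec = 0 := by
    have := congrArg vec h
    rwa [mul_vec, vec_add_self, eq_comm] at this
  have hs := congrArg sign h
  rw [mul_sign, hv, hφ.zero_left, units_mul_self, one_mul] at hs
  exact CodeLoop.ext hs.symm hv

theorem signElt_zero_mul_self (hφ : V.IsFactorSet φ) :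
    signElt V φ 0 * signElt V φ 0 = signElt V φ 0 := by
  ext1
  · rw [mul_sign, signElt_vec, hφ.zero_left]
    rfl
  · exact vec_add_self _

theorem mul_eq_signElt_zero_iff {x y : CodeLoop V φ} :
    x * y = signElt V φ 0 ↔ y = x⁻¹ := by
  constructor
  · intro h
    have hv : y.vec = x.vec := by
      have := congrArg vec h
      rw [mul_vec, signElt_vec] at this
      rw [eq_neg_of_add_eq_zero_right this, ZModModule.neg_eq_self]
    have hs := congrArg sign h
    rw [mul_sign, hv, signElt_sign, pow_zero] at hs
    refine CodeLoop.ext ?_ hv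
    rw [inv_sign]
    calc y.sign = (x.sign * y.sign * φ x.vec x.vec) * (x.sign * φ x.vec x.vec) := by
          rw [show x.sign * y.sign * φ x.vec x.vec * (x.sign * φ x.vec x.vec) =
            (x.sign * x.sign) * (φ x.vec x.vec * φ x.vec x.vec) * y.sign by ac_rfl,
            units_mul_self, units_mul_self, one_mul, one_mul]
      _ = _ := by rw [hs, one_mul]
  · rintro rfl
    ext1
    · rw [mul_sign, inv_sign, inv_vec, signElt_sign, pow_zero,
        show x.sign * (x.sign * φ x.vec x.vec) * φ x.vec x.vec =
          (x.sign * x.sign) * (φ x.vec x.vec * φ x.vec x.vec) by ac_rfl,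
        units_mul_self, units_mul_self, one_mul]
    · exact vec_add_self _

section Isomorphism

variable (f : CodeLoop V φ ≃* CodeLoop W ψ)

theorem map_signElt_zero (hφ : V.IsFactorSet φ) (hψ : W.IsFactorSet ψ) :
    f (signElt V φ 0) = signElt W ψ 0 :=
  eq_signElt_zero_of_mul_self hψ (by rw [← map_mul, signElt_zero_mul_self hφ])

theorem map_inv_eq (hφ : V.IsFactorSet φ) (hψ : W.IsFactorSet ψ) (x : CodeLoop V φ) :
    f x⁻¹ = (f x)⁻¹ := by
  rw [← mul_eq_signElt_zero_iff, ← map_mul, mul_eq_signElt_zero_iff.2 rfl,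
    map_signElt_zero f hφ hψ]

theorem map_comm_eq (hφ : V.IsFactorSet φ) (hψ : W.IsFactorSet ψ) (x y : CodeLoop V φ) :
    f (comm x y) = comm (f x) (f y) := by
  simp only [comm, map_mul, map_inv_eq f hφ hψ]

theorem map_assoc_eq (hφ : V.IsFactorSet φ) (hψ : W.IsFactorSet ψ) (x y z : CodeLoop V φ) :
    f (assoc x y z) = assoc (f x) (f y) (f z) := by
  simp only [assoc, map_mul, map_inv_eq f hφ hψ]

/-- An isomorphism between nonassociative code loops fixes `-1`. -/
theorem map_signElt (hφ : V.IsFactorSet φ) (hψ : W.IsFactorSet ψ) {x y z : CodeLoop V φ}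
    (h : assoc x y z = signElt V φ 1) (k : ℕ) : f (signElt V φ k) = signElt W ψ k := by
  rcases Nat.mod_two_eq_zero_or_one k with hk | hk
  · rw [(signElt_eq_iff (k := 0)).2 hk, (signElt_eq_iff (k := 0)).2 hk, map_signElt_zero f hφ hψ]
  · rw [(signElt_eq_iff (k := 1)).2 hk, (signElt_eq_iff (k := 1)).2 hk]
    -- The image of -1 is an associator, hence ±1; injectivity rules out 1.
    have h1 : f (signElt V φ 1) = signElt W ψ (hammingNorm (((f x).vec : Fin n → ZMod 2) *
        ((f y).vec : Fin n → ZMod 2) * ((f z).vec : Fin n → ZMod 2))) := by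
      rw [← h, map_assoc_eq f hφ hψ, assoc_eq hψ]
    rw [h1, signElt_eq_iff]
    rcases Nat.mod_two_eq_zero_or_one (hammingNorm (((f x).vec : Fin n → ZMod 2) *
      ((f y).vec : Fin n → ZMod 2) * ((f z).vec : Fin n → ZMod 2))) with h0 | h0
    · rw [(signElt_eq_iff (k := 0)).2 h0, ← map_signElt_zero f hφ hψ,
        f.injective.eq_iff, signElt_eq_iff] at h1
      exact absurd h1 (by decide)
    · exact h0

theorem HasCharVector.map (hφ : V.IsFactorSet φ) (hψ : W.IsFactorSet ψ)
    {x : Fin 4 → CodeLoop V φ} {l : Fin 10 → ℕ} (h : HasCharVector x l) :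
    HasCharVector (f ∘ x) l := by
  have hs := map_signElt f hφ hψ h.assoc_abc
  constructor <;>
    simp only [Function.comp_apply, ← map_mul, ← map_comm_eq f hφ hψ, ← map_assoc_eq f hφ hψ,
      ← hs, f.injective.eq_iff]
  exacts [h.1, h.2, h.3, h.4, h.5, h.6, h.7, h.8, h.9, h.10, h.11, h.12, h.13, h.14]

theorem closure_range_comp {x : Fin 4 → CodeLoop V φ}
    (h : Subsemigroup.closure (Set.range x) = ⊤) :
    Subsemigroup.closure (Set.range (f ∘ x)) = ⊤ := by
  have := MulHom.map_mclosure (f : CodeLoop V φ →ₙ* CodeLoop W ψ) (Set.range x)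
  rw [h, ← Set.range_comp] at this
  refine Eq.trans this.symm ?_
  rw [eq_top_iff]
  intro y _
  exact ⟨f.symm y, trivial, f.apply_symm_apply y⟩

end Isomorphism

/-- The bridge from the loop to the code: exactness of the divisions by 4 and 2 turns parities of
quotients into weights mod 8 and intersections mod 4. -/
theorem hasCharVector_iff (hV : V.IsDoublyEven) (hφ : V.IsFactorSet φ) (x : Fin 4 → CodeLoop V φ)
    (l : Fin 10 → ℕ) :
    HasCharVector x l ↔ HasWeightType (fun k => ((x k).vec : Fin m → ZMod 2)) l := by
  have h4 (v : V) (t : ℕ) : hammingNorm (v : Fin m → ZMod 2) / 4 % 2 = t % 2 ↔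
      hammingNorm (v : Fin m → ZMod 2) % 8 = 4 * t % 8 := by
    have := hV v v.2
    omega
  have h2 (v w : V) (t : ℕ) :
      hammingNorm ((v : Fin m → ZMod 2) * (w : Fin m → ZMod 2)) / 2 % 2 = t % 2 ↔
      hammingNorm ((v : Fin m → ZMod 2) * (w : Fin m → ZMod 2)) % 4 = 2 * t % 4 := by
    have := hV.two_dvd v w
    omega
  constructor
  · intro h
    obtain ⟨h1, h2', h3, h4', h5, h6, h7, h8, h9, h10, h11, h12, h13, h14⟩ := h
    simp only [mul_self_eq hφ, comm_eq hV hφ, assoc_eq hφ, signElt_eq_iff, h4, h2] at *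
    exact ⟨h1, h2', h3, h4', h5, h6, h7, h8, h9, h10, h11, h12, h13, h14⟩
  · intro h
    constructor <;>
      simp only [mul_self_eq hφ, comm_eq hV hφ, assoc_eq hφ, signElt_eq_iff, h4, h2]
    exacts [h.1, h.2, h.3, h.4, h.5, h.6, h.7, h.8, h.9, h.10, h.11, h.12, h.13, h.14]

theorem span_vec_eq {x : Fin 4 → CodeLoop V φ} (h : Subsemigroup.closure (Set.range x) = ⊤) :
    Submodule.span (ZMod 2) (Set.range fun k => ((x k).vec : Fin m → ZMod 2)) = V := by
  apply le_antisymm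
  · rw [Submodule.span_le]
    rintro _ ⟨k, rfl⟩
    exact (x k).vec.2
  · intro v hv
    have key (y : CodeLoop V φ) (hy : y ∈ Subsemigroup.closure (Set.range x)) :
        (y.vec : Fin m → ZMod 2) ∈
          Submodule.span (ZMod 2) (Set.range fun k => ((x k).vec : Fin m → ZMod 2)) := by
      induction hy using Subsemigroup.closure_induction with
      | mem y hy =>
        obtain ⟨k, rfl⟩ := hy
        exact Submodule.subset_span ⟨k, rfl⟩
      | mul y z _ _ hy hz => exact Submodule.add_mem _ hy hz
    exact key ⟨1, ⟨v, hv⟩⟩ (h ▸ trivial)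

/-- A code loop with an associator `-1` is generated by any elements over a spanning set. -/
theorem closure_eq_top (hφ : V.IsFactorSet φ) {x : Fin 4 → CodeLoop V φ}
    (hV : Submodule.span (ZMod 2) (Set.range fun k => ((x k).vec : Fin m → ZMod 2)) = V)
    (h : assoc (x 0) (x 1) (x 2) = signElt V φ 1) :
    Subsemigroup.closure (Set.range x) = ⊤ := by
  set S := Subsemigroup.closure (Set.range x)
  have hx (k : Fin 4) : x k ∈ S := Subsemigroup.subset_closure ⟨k, rfl⟩
  have sign_mul (k : ℕ) (y : CodeLoop V φ) :
      signElt V φ k * y = ⟨(-1) ^ k * y.sign, y.vec⟩ := by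
    ext1
    · rw [mul_sign, signElt_vec, hφ.zero_left, mul_one]
      rfl
    · exact zero_add _
  have hinv {y : CodeLoop V φ} (hy : y ∈ S) : y⁻¹ ∈ S := by
    -- Closure under products alone yields inverses, as y² = ±1; the associator -1 then lies in S.
    have : y⁻¹ = (y * y) * y := by
      rw [mul_self_eq hφ, sign_mul, ← hφ.diag]
      exact CodeLoop.ext (mul_comm _ _) rfl
    rw [this]
    exact S.mul_mem (S.mul_mem hy hy) hy
  have hneg : signElt V φ 1 ∈ S := by
    rw [← h]
    exact S.mul_mem (S.mul_mem (S.mul_mem (hx 0) (hx 1)) (hx 2))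
      (hinv (S.mul_mem (hx 0) (S.mul_mem (hx 1) (hx 2))))
  have hvec (v : Fin m → ZMod 2)
      (hv : v ∈ Submodule.span (ZMod 2) (Set.range fun k => ((x k).vec : Fin m → ZMod 2))) :
      ∃ y ∈ S, (y.vec : Fin m → ZMod 2) = v := by
    induction hv using Submodule.span_induction with
    | mem v hv =>
      obtain ⟨k, rfl⟩ := hv
      exact ⟨x k, hx k, rfl⟩
    | zero =>
      refine ⟨x 0 * x 0, S.mul_mem (hx 0) (hx 0), ?_⟩
      rw [mul_vec, vec_add_self]
      rfl
    | add u v _ _ hu hv =>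
      obtain ⟨y, hy, rfl⟩ := hu
      obtain ⟨z, hz, rfl⟩ := hv
      exact ⟨y * z, S.mul_mem hy hz, rfl⟩
    | smul a v _ hv =>
      obtain ⟨y, hy, rfl⟩ := hv
      obtain rfl | rfl : a = 0 ∨ a = 1 := by revert a; decide
      · refine ⟨y * y, S.mul_mem hy hy, ?_⟩
        rw [mul_vec, vec_add_self, zero_smul]
        rfl
      · exact ⟨y, hy, (one_smul _ _).symm⟩
  rw [eq_top_iff]
  intro z _
  obtain ⟨y, hy, hyz⟩ := hvec z.vec (by rw [hV]; exact z.vec.2)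
  have hyz : y.vec = z.vec := Subtype.ext hyz
  by_cases hs : y.sign = z.sign
  · rwa [← CodeLoop.ext hs hyz]
  · have : signElt V φ 1 * y = z := by
      rw [sign_mul]
      refine CodeLoop.ext ?_ hyz
      rw [pow_one, neg_one_mul]
      rcases Int.units_eq_one_or y.sign with h1 | h1 <;>
        rcases Int.units_eq_one_or z.sign with h2 | h2 <;> simp_all
    rw [← this]
    exact S.mul_mem hneg hy

/-- A code loop is in bijection with `{1, -1} × V`. -/
def equivProd (V : BinaryCode m) (φ : V → V → ℤˣ) : CodeLoop V φ ≃ ℤˣ × V where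
  toFun x := (x.sign, x.vec)
  invFun p := ⟨p.1, p.2⟩
  left_inv _ := rfl
  right_inv _ := rfl

/-- A code loop has 2 · 2^dim elements, so its order determines the rank. -/
theorem finrank_eq_of_mulEquiv (f : CodeLoop V φ ≃* CodeLoop W ψ) :
    Module.finrank (ZMod 2) V = Module.finrank (ZMod 2) W := by
  have h := Nat.card_congr (((equivProd V φ).symm.trans f.toEquiv).trans (equivProd W ψ))
  rw [Nat.card_prod, Nat.card_prod, Module.natCard_eq_pow_finrank (K := ZMod 2) (V := V),
    Module.natCard_eq_pow_finrank (K := ZMod 2) (V := W), Nat.card_zmod] at h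
  exact Nat.pow_right_injective le_rfl (Nat.eq_of_mul_eq_mul_left Nat.card_pos h)

end CodeLoop

/-! ### Representations as bases satisfying the congruences -/

section Representations

variable {L : Type*} [Mul L] {l : Fin 10 → ℕ} {m : ℕ} {V : BinaryCode m}

/-- A representation of a code loop of rank `4` has a basis whose weights and intersections are
given by the characteristic vector. -/
theorem IsCodeLoopOfCharVector.exists_basis (hL : IsCodeLoopOfCharVector L l)
    (hV : IsRepresentation L V) :
    ∃ w : Fin 4 → Fin m → ZMod 2, LinearIndependent (ZMod 2) w ∧
      Submodule.span (ZMod 2) (Set.range w) = V ∧ HasWeightType w l := by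
  obtain ⟨n, W, φ, hW, hφ, hr, ⟨g⟩, x, hx, hc⟩ := hL
  obtain ⟨hV, ψ, hψ, ⟨g'⟩⟩ := hV
  let f : CodeLoop W φ ≃* CodeLoop V ψ := g.symm.trans g'
  have hspan := CodeLoop.span_vec_eq (CodeLoop.closure_range_comp f hx)
  refine ⟨fun k => ((f ∘ x) k).vec, ?_, hspan,
    (CodeLoop.hasCharVector_iff hV hψ _ l).1 (hc.map f hφ hψ)⟩
  rw [linearIndependent_iff_card_eq_finrank_span, Set.finrank, hspan,
    ← CodeLoop.finrank_eq_of_mulEquiv f, hr, Fintype.card_fin]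

/-- In the two bases both quarter weights are the same cubic form, so matching the bases preserves
it and the given factor set pulls back; uniqueness of factor sets is not needed. -/
theorem IsCodeLoopOfCharVector.isRepresentation (hL : IsCodeLoopOfCharVector L l)
    {v : Fin 4 → Fin m → ZMod 2} (hli : LinearIndependent (ZMod 2) v)
    (hspan : Submodule.span (ZMod 2) (Set.range v) = V) (hv : HasWeightType v l) :
    IsRepresentation L V := by
  have hVe := hv.isDoublyEven hli hspan
  obtain ⟨n, W, φ, hW, hφ, -, ⟨g⟩, -⟩ := id hL
  obtain ⟨w, hwli, hwspan, hw⟩ := hL.exists_basis ⟨hW, φ, hφ, ⟨g⟩⟩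
  let f : V ≃ₗ[ZMod 2] W := (basisEquiv hli hspan).symm.trans (basisEquiv hwli hwspan)
  refine ⟨hVe, _, hφ.comp_linearEquiv hVe hW f fun u => ?_, ⟨g.trans (CodeLoop.congr φ f).symm⟩⟩
  rw [LinearEquiv.trans_apply, hw.quarterWeight_basisEquiv, ← hv.quarterWeight_basisEquiv hli hspan,
    LinearEquiv.apply_symm_apply]

theorem HasWeightType.exists_isCodeLoopOfCharVector {v : Fin 4 → Fin m → ZMod 2}
    (hv : HasWeightType v l) (hli : LinearIndependent (ZMod 2) v) :
    ∃ (C : Type) (_ : Mul C), IsCodeLoopOfCharVector C l := by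
  have hφ := hv.isFactorSet hli rfl
  have hV := hv.isDoublyEven hli rfl
  set φ : Submodule.span (ZMod 2) (Set.range v) → Submodule.span (ZMod 2) (Set.range v) → ℤˣ :=
    fun u w => signChar (factorForm l ((basisEquiv hli rfl).symm u) ((basisEquiv hli rfl).symm w))
  let x : Fin 4 → CodeLoop (Submodule.span (ZMod 2) (Set.range v)) φ := fun k =>
    ⟨1, ⟨v k, Submodule.subset_span ⟨k, rfl⟩⟩⟩
  have hc := (CodeLoop.hasCharVector_iff hV hφ x l).2 hv
  refine ⟨CodeLoop _ φ, inferInstance, m, _, φ, hV, hφ, ?_, ⟨MulEquiv.refl _⟩, x,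
    CodeLoop.closure_eq_top hφ rfl hc.assoc_abc, hc⟩
  rw [finrank_span_eq_card hli, Fintype.card_fin]

end Representations

/-! ### Verification for the listed codes and conclusion -/

namespace RankFour

theorem hasWeightType_gen (i : Fin 16) : HasWeightType (gen i) (charVector i) := by
  revert i
  have (i : Fin 16) : (hammingNorm (gen i 0) % 8 = 4 * charVector i 0 % 8 ∧
      hammingNorm (gen i 1) % 8 = 4 * charVector i 1 % 8 ∧
      hammingNorm (gen i 2) % 8 = 4 * charVector i 2 % 8 ∧
      hammingNorm (gen i 3) % 8 = 4 * charVector i 3 % 8) ∧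
      (hammingNorm (gen i 0 * gen i 1) % 4 = 2 * charVector i 4 % 4 ∧
      hammingNorm (gen i 0 * gen i 2) % 4 = 2 * charVector i 5 % 4 ∧
      hammingNorm (gen i 0 * gen i 3) % 4 = 2 * charVector i 6 % 4 ∧
      hammingNorm (gen i 1 * gen i 2) % 4 = 2 * charVector i 7 % 4 ∧
      hammingNorm (gen i 1 * gen i 3) % 4 = 2 * charVector i 8 % 4 ∧
      hammingNorm (gen i 2 * gen i 3) % 4 = 2 * charVector i 9 % 4) ∧
      hammingNorm (gen i 0 * gen i 1 * gen i 2) % 2 = 1 ∧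
      hammingNorm (gen i 0 * gen i 1 * gen i 3) % 2 = 0 ∧
      hammingNorm (gen i 0 * gen i 2 * gen i 3) % 2 = 0 ∧
      hammingNorm (gen i 1 * gen i 2 * gen i 3) % 2 = 0 := by
    revert i
    decide +kernel
  intro i
  obtain ⟨⟨h1, h2, h3, h4⟩, ⟨h5, h6, h7, h8, h9, h10⟩, h11, h12, h13, h14⟩ := this i
  exact ⟨h1, h2, h3, h4, h5, h6, h7, h8, h9, h10, h11, h12, h13, h14⟩

theorem linearIndependent_gen (i : Fin 16) : LinearIndependent (ZMod 2) (gen i) := by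
  rw [Fintype.linearIndependent_iff]
  have key : ∀ (i : Fin 16) (c : Fin 4 → ZMod 2),
      (∀ j, c 0 * gen i 0 j + c 1 * gen i 1 j + c 2 * gen i 2 j + c 3 * gen i 3 j = 0) →
        ∀ k, c k = 0 := by
    decide +kernel
  intro c hc
  refine key i c fun j => ?_
  simpa [Fin.sum_univ_four] using congrFun hc j

theorem exists_gen_ne_zero (i : Fin 16) (j : Fin (degree i)) : ∃ k, gen i k j ≠ 0 := by
  revert i
  decide +kernel

theorem card_coordClass_lt (i : Fin 16) (j : Fin (degree i)) :
    (Finset.univ.filter fun j' => ∀ k, gen i k j = gen i k j').card < 8 := by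
  revert i
  decide +kernel

theorem isReducedRepresentation_code {C : Type*} [Mul C] {i : Fin 16}
    (hC : IsCodeLoopOfCharVector C (charVector i)) : IsReducedRepresentation C (code i) where
  isRepresentation := hC.isRepresentation (linearIndependent_gen i) rfl (hasWeightType_gen i)
  support j := by
    obtain ⟨k, hk⟩ := exists_gen_ne_zero i j
    exact ⟨gen i k, Submodule.subset_span ⟨k, rfl⟩, hk⟩
  card_lt j := by
    refine lt_of_le_of_lt ?_ (card_coordClass_lt i j)
    rw [← Set.ncard_coe_finset]
    refine Set.ncard_le_ncard (fun j' hj' => ?_) (Set.toFinite _)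
    simpa using fun k => hj' (gen i k) (Submodule.subset_span ⟨k, rfl⟩)

theorem map_patternMultiplicity {i : Fin 16} {n : ℕ} {w : Fin 4 → Fin n → ZMod 2}
    (hw : HasWeightType w (charVector i)) (hli : LinearIndependent (ZMod 2) w)
    (hn : n ≤ degree i) :
    [8, 4, 2, 12, 10, 6, 14, 1, 9, 5, 13, 3, 11, 15, 7].map (patternMultiplicity w) =
      multiplicities i :=
  hw.multiplicity_eq (hli.ne_zero 3) (degree_le i) hn (congruenceSearch_multiplicities i)

/-- The multiplicity of the pattern `0` and those of the others add up to the length. -/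
theorem patternMultiplicity_zero_add {n : ℕ} (w : Fin 4 → Fin n → ZMod 2) :
    patternMultiplicity w 0 +
      ([8, 4, 2, 12, 10, 6, 14, 1, 9, 5, 13, 3, 11, 15, 7].map (patternMultiplicity w)).sum =
      n := by
  conv_rhs => rw [← sum_patternMultiplicity w]
  simp only [List.map_cons, List.map_nil, List.sum_cons, List.sum_nil, Fin.sum_univ_succ,
    Fin.sum_univ_zero]
  simp
  omega

theorem sum_multiplicities (i : Fin 16) : (multiplicities i).sum = degree i := by
  revert i
  decide

/-- A shorter representation would still have the listed multiplicities, whose sum already exceeds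
its length. -/
theorem degree_le_of_isRepresentation {C : Type*} [Mul C] {i : Fin 16}
    (hC : IsCodeLoopOfCharVector C (charVector i)) {n : ℕ} {W : BinaryCode n}
    (hW : IsRepresentation C W) : degree i ≤ n := by
  obtain ⟨w, hli, -, hw⟩ := hC.exists_basis hW
  by_contra! hn
  have h := patternMultiplicity_zero_add w
  rw [map_patternMultiplicity hw hli hn.le, sum_multiplicities] at h
  omega

theorem patternMultiplicity_eq {i : Fin 16} {w w' : Fin 4 → Fin (degree i) → ZMod 2}
    (hw : HasWeightType w (charVector i)) (hli : LinearIndependent (ZMod 2) w)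
    (hw' : HasWeightType w' (charVector i)) (hli' : LinearIndependent (ZMod 2) w') :
    patternMultiplicity w = patternMultiplicity w' := by
  have h := map_patternMultiplicity hw hli le_rfl
  rw [← map_patternMultiplicity hw' hli' le_rfl, List.map_inj_left] at h
  -- The search covers nonzero patterns only; equal lengths settle the pattern 0.
  have h0 := (patternMultiplicity_zero_add w).trans (patternMultiplicity_zero_add w').symm
  rw [List.map_congr_left h, Nat.add_right_cancel_iff] at h0
  funext q
  by_cases hq : q = 0
  · rw [hq, h0]
  · refine h q ?_
    revert q
    decide

end RankFour

theorem theorem3p6 (i : Fin 16) :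
    -- a code loop with the `i`-th characteristic vector exists
    (∃ (C : Type) (_ : Mul C), IsCodeLoopOfCharVector C (RankFour.charVector i)) ∧
    -- the four listed generators are independent
    LinearIndependent (ZMod 2) (RankFour.gen i) ∧
    ∀ (C : Type*) [Mul C], IsCodeLoopOfCharVector C (RankFour.charVector i) →
      -- `V i` is a minimal representation of that loop
      IsMinimalRepresentation C (RankFour.code i) ∧
      -- and every minimal representation has the degree of `V i` and is equivalent to it;
      -- in fact every representation of that degree, reduced or not, is
      (∀ (n : ℕ) (W : BinaryCode n), IsMinimalRepresentation C W → n = RankFour.degree i) ∧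
      (∀ W : BinaryCode (RankFour.degree i), IsRepresentation C W →
        W.IsEquivalent (RankFour.code i)) := by
  refine ⟨(RankFour.hasWeightType_gen i).exists_isCodeLoopOfCharVector
    (RankFour.linearIndependent_gen i), RankFour.linearIndependent_gen i, fun C _ hC => ?_⟩
  have hred := RankFour.isReducedRepresentation_code hC
  refine ⟨⟨hred, fun n W hW => RankFour.degree_le_of_isRepresentation hC hW⟩, fun n W hW => ?_,
    fun W hW => ?_⟩
  · exact le_antisymm (hW.degree_le _ _ hred.isRepresentation)
      (RankFour.degree_le_of_isRepresentation hC hW.isReduced.isRepresentation)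
  · obtain ⟨w, hli, hspan, hw⟩ := hC.exists_basis hW
    exact BinaryCode.isEquivalent_of_multiplicity_eq hspan rfl
      (RankFour.patternMultiplicity_eq hw hli (RankFour.hasWeightType_gen i)
        (RankFour.linearIndependent_gen i))
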